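/- Let $d\in\mathbb N$, $0<T<\infty$, $0<\gamma_1$ and $\gamma_2,\gamma_3\in\mathbb R$. Suppose that the coefficients satisfy the following assumptions: 1. $\beta\in C^1(\mathbb R)$, $\beta(0)=0$, and there is $\alpha_0>0$ with $\beta'(r)\ge\alpha_0$ for all $r\in\mathbb R$; 2. $b\in C(\mathbb R)$ is bounded and $D\in L^\infty(\mathbb R^d;\mathbb R^d)$; 3. $\beta$ is Lipschitz continuous; 4. there is $\alpha_2\ge 0$ with $|b(x)x-b(y)y|\le\alpha_2|\beta(x)-\beta(y)|$ for all $x,y\in\mathbb R$. Let $u\in L^\infty((0,T)\times\mathbb R^d)$ be an admissible control, that is, $\gamma_1\le u\le\gamma_2$ a.e. on $(0,T)\times\mathbb R^d$ and, for a.e. $t\in(0,T)$, $\Delta u(t,\cdot)\le\gamma_3$ in the sense of distributions on $\mathbb R^d$ (controls $u=u(x)$ that do not depend on time are included). Let $H^{-1}=H^{-1}(\mathbb R^d)$ be the dual of $H^1(\mathbb R^d)$, and consider the triple $L^2(\mathbb R^d)\subset H^{-1}\subset (L^2(\mathbb R^d))^*$ with pivot space $H^{-1}$. Thus $h\in H^{-1}$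 acts on $L^2$ by $v\mapsto\int_{\mathbb R^d}[(I-\Delta)^{-1}h]\,v\,dx$, and $(L^2)^*$ is identified with the space $(I-\Delta)L^2(\mathbb R^d)$ of distributions, $(I-\Delta)f$ with $f\in L^2$ acting on $L^2$ by $v\mapsto\int_{\mathbb R^d}f\,v\,dx$. For $t\in(0,T)$ and $y\in L^2(\mathbb R^d)$ set $$A(t)y=-\Delta\big(u(t,\cdot)\,\beta(y)\big)+\operatorname{div}\big(D\,b(y)\,y\big)$$ in the sense of distributions on $\mathbb R^d$. Then for every $\rho_0\in H^{-1}$ the nonlinear Fokker–Planck equation $$\partial_t\rho-\Delta(u\beta(\rho))+\operatorname{div}(D\,b(\rho)\rho)=0,\qquad \rho(0)=\rho_0,$$ has a solution $\rho\in C([0,T];H^{-1})\cap L^2(0,T;L^2(\mathbb R^d))$ in the following sense: $\rho\colon[0,T]\to(L^2)^*$ is absolutely continuous and differentiable almost everywhere, with $\frac{d\rho}{dt}\in L^2(0,T;(L^2)^*)$, $$\frac{d\rho}{dt}(t)+A(t)\rho(t)=0\quad\text{for a.e. }t\in(0,T),\qquad \rho(0)=\rho_0.$$ -/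

import Mathlib

open MeasureTheory Set
open scoped Distributions LineDeriv ENNReal

noncomputable section

namespace FokkerPlanck

/-! ### Distributions on `ℝ^d` -/

/-- The Euclidean space `ℝ^d`. -/
abbrev Rd (d : ℕ) := EuclideanSpace ℝ (Fin d)

/-- The `i`-th standard basis vector of `ℝ^d`. -/
abbrev e {d : ℕ} (i : Fin d) : Rd d := EuclideanSpace.single i (1 : ℝ)

/-- Real test functions `𝓓(ℝ^d) = C_c^∞(ℝ^d)`. -/
abbrev Test (d : ℕ) := 𝓓((⊤ : TopologicalSpace.Opens (Rd d)), ℝ)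

/-- Real distributions `𝓓'(ℝ^d)`. -/
abbrev Distr (d : ℕ) := 𝓓'((⊤ : TopologicalSpace.Opens (Rd d)), ℝ)

/-- The distribution `φ ↦ ∫ φ f dx` given by a locally integrable function `f`
(by convention `0` if `f` is not locally integrable). -/
def ofFun {d : ℕ} (f : Rd d → ℝ) : Distr d :=
  (TestFunction.integralAgainstBilinCLM (ContinuousLinearMap.mul ℝ ℝ) volume f :
    Test d →L[ℝ] ℝ)

/-- The distributional Laplacian `∑ᵢ Dᵢ Dᵢ S`. -/
def lap {d : ℕ} (S : Distr d) : Distr d :=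
  ∑ i : Fin d, ∂_{(e i : Rd d)} (∂_{(e i : Rd d)} S)

/-- The distributional divergence `∑ᵢ Dᵢ Sᵢ`. -/
def dvg {d : ℕ} (S : Fin d → Distr d) : Distr d :=
  ∑ i : Fin d, ∂_{(e i : Rd d)} (S i)

/-! ### The space `V = L²` -/

/-- `V = L²(ℝ^d)`. -/
abbrev L2 (d : ℕ) := Lp ℝ 2 (volume : Measure (Rd d))

theorem memLp_test {d : ℕ} (φ : Test d) : MemLp φ 2 (volume : Measure (Rd d)) :=
  φ.continuous.memLp_of_hasCompactSupport φ.hasCompactSupport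

theorem ofFun_L2_apply {d : ℕ} (v : L2 d) (φ : Test d) :
    ofFun v φ = inner ℝ ((memLp_test φ).toLp φ) v := by
  have h : LocallyIntegrableOn (v : Rd d → ℝ) ((⊤ : TopologicalSpace.Opens (Rd d)) : Set (Rd d))
      volume :=
    ((Lp.memLp v).locallyIntegrable (by norm_num)).locallyIntegrableOn _
  have h1 : ofFun v φ = ∫ x, (ContinuousLinearMap.mul ℝ ℝ) (φ x) (v x) :=
    TestFunction.integralAgainstBilinCLM_eq_integral h
  rw [h1, L2.inner_def]
  refine integral_congr_ae ?_
  filter_upwards [(memLp_test φ).coeFn_toLp] with x hx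
  rw [hx]
  simp [mul_comm]

/-! ### The Hilbert space `H¹` and the triple `L² ⊂ H⁻¹ ⊂ (L²)*` -/

/-- `H¹(ℝ^d)`, realised as the space of all pairs `(v, g)` with `v ∈ L²` and `g ∈ (L²)^d` such
that `Dᵢ v = gᵢ` in the sense of distributions. The inner product is the one inherited from
`L² × (L²)^d`, that is `∫ v w dx + ∑ᵢ ∫ Dᵢ v Dᵢ w dx`. -/
def H1 (d : ℕ) : Submodule ℝ (WithLp 2 (L2 d × PiLp 2 (fun _ : Fin d => L2 d))) where
  carrier := {p | ∀ i : Fin d, ∂_{(e i : Rd d)} (ofFun p.fst) = ofFun (p.snd i)}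
  add_mem' := by
    intro p q hp hq i
    ext φ
    have h1 := congrArg (fun S : Distr d => S φ) (hp i)
    have h2 := congrArg (fun S : Distr d => S φ) (hq i)
    simp only [Distribution.lineDerivOp_apply_apply, ofFun_L2_apply] at h1 h2 ⊢
    simp only [WithLp.add_fst, WithLp.add_snd, PiLp.add_apply, inner_add_right, h1, h2]
  zero_mem' := by
    intro i
    ext φ
    simp only [Distribution.lineDerivOp_apply_apply, ofFun_L2_apply]
    simp
  smul_mem' := by
    intro c p hp i
    ext φ
    have h1 := congrArg (fun S : Distr d => S φ) (hp i)
    simp only [Distribution.lineDerivOp_apply_apply, ofFun_L2_apply] at h1 ⊢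
    simp only [WithLp.smul_fst, WithLp.smul_snd, PiLp.smul_apply, inner_smul_right, h1]

theorem isClosed_H1 (d : ℕ) :
    IsClosed (H1 d : Set (WithLp 2 (L2 d × PiLp 2 (fun _ : Fin d => L2 d)))) := by
  have : (H1 d : Set (WithLp 2 (L2 d × PiLp 2 (fun _ : Fin d => L2 d)))) =
      ⋂ (i : Fin d) (φ : Test d), {p |
        inner ℝ ((memLp_test (-∂_{(e i : Rd d)} φ)).toLp (-∂_{(e i : Rd d)} φ : Test d)) p.fst =
        inner ℝ ((memLp_test φ).toLp φ) (p.snd i)} := by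
    ext p
    simp only [mem_iInter, mem_ofPred_eq]
    constructor
    · intro hp i φ
      have h1 := congrArg (fun S : Distr d => S φ) (hp i)
      simpa only [Distribution.lineDerivOp_apply_apply, ofFun_L2_apply] using h1
    · intro hp i
      ext φ
      simpa only [Distribution.lineDerivOp_apply_apply, ofFun_L2_apply] using hp i φ
  rw [this]
  refine isClosed_iInter fun i => isClosed_iInter fun φ => isClosed_eq ?_ ?_ <;> fun_prop

instance (d : ℕ) : CompleteSpace (H1 d) := (isClosed_H1 d).completeSpace_coe

/-- The inclusion `H¹ → L²`, `(v, ∇v) ↦ v`. -/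
def H1toL2 (d : ℕ) : H1 d →L[ℝ] L2 d :=
  (WithLp.fstL 2 ℝ (L2 d) (PiLp 2 (fun _ : Fin d => L2 d))).comp (H1 d).subtypeL

/-- `H = H⁻¹(ℝ^d)`, the dual of `H¹(ℝ^d)`. -/
abbrev Hm1 (d : ℕ) := StrongDual ℝ (H1 d)

/-- The operator `(I - Δ)⁻¹ : H⁻¹ → H¹`, i.e. the Riesz isomorphism of the Hilbert space `H¹`:
`w = (I - Δ)⁻¹ h` iff `∫ w φ dx + ∫ ∇w · ∇φ dx = h(φ)` for all `φ ∈ H¹`. -/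
def invIdSubLap {d : ℕ} (h : Hm1 d) : H1 d := (InnerProductSpace.toDual ℝ (H1 d)).symm h

/-- The embedding `L² ⊂ H⁻¹`: `v` acts on `H¹` by `φ ↦ ∫ v φ dx`. -/
def L2toHm1 {d : ℕ} (v : L2 d) : Hm1 d := (innerSL ℝ v).comp (H1toL2 d)

/-- `V* = (L²)*`, the dual of `V = L²`. -/
abbrev VDual (d : ℕ) := StrongDual ℝ (L2 d)

/-- The embedding `H⁻¹ ⊂ (L²)*` with `H⁻¹` as pivot space: `h` acts on `L²` by
`v ↦ (h, v)_{H⁻¹} = ∫ [(I - Δ)⁻¹ h] v dx`. -/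
def Hm1toVDual {d : ℕ} (h : Hm1 d) : VDual d := innerSL ℝ (H1toL2 d (invIdSubLap h))

/-- The identification of `V* = (L²)*` with the space `(I - Δ) L²` of distributions: the
functional `v ↦ ∫ f v dx` on `L²`, `f ∈ L²`, is the distribution `(I - Δ) f`. -/
def VDualToDistr {d : ℕ} (l : VDual d) : Distr d :=
  ofFun ((InnerProductSpace.toDual ℝ (L2 d)).symm l : L2 d) -
    lap (ofFun ((InnerProductSpace.toDual ℝ (L2 d)).symm l : L2 d))

/-! ### The equation -/

/-- The assumptions on the coefficients `β`, `b`, `D`. -/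
structure CoefficientAssumption {d : ℕ} (β b : ℝ → ℝ) (D : Rd d → Rd d) : Prop where
  contDiff_beta : ContDiff ℝ 1 β
  deriv_beta : ∃ α₀ : ℝ, 0 < α₀ ∧ ∀ r, α₀ ≤ deriv β r
  beta_zero : β 0 = 0
  continuous_b : Continuous b
  bounded_b : ∃ C : ℝ, ∀ r, |b r| ≤ C
  memLp_D : MemLp D ∞ volume
  lipschitz_beta : ∃ L : NNReal, LipschitzWith L β
  compare : ∃ α₂ : ℝ, 0 ≤ α₂ ∧ ∀ x y, |b x * x - b y * y| ≤ α₂ * |β x - β y|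

/-- The set of admissible controls: `u ∈ L^∞((0,T) × ℝ^d)` with `γ₁ ≤ u ≤ γ₂` a.e. and
`Δ u(t,·) ≤ γ₃` on `ℝ^d` in the sense of distributions, for a.e. `t ∈ (0,T)`. -/
structure IsAdmissible {d : ℕ} (T γ₁ γ₂ γ₃ : ℝ) (u : ℝ → Rd d → ℝ) : Prop where
  measurable : AEStronglyMeasurable (fun p : ℝ × Rd d => u p.1 p.2)
    ((volume.restrict (Ioo 0 T)).prod volume)
  bounds : ∀ᵐ p : ℝ × Rd d ∂((volume.restrict (Ioo 0 T)).prod volume),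
    γ₁ ≤ u p.1 p.2 ∧ u p.1 p.2 ≤ γ₂
  laplacian_le : ∀ᵐ t ∂(volume.restrict (Ioo 0 T)), ∀ φ : Test d, (∀ x, 0 ≤ φ x) →
    lap (ofFun (u t)) φ ≤ γ₃ * ∫ x, φ x

/-- The operator `A y = -Δ(u β(y)) + div(D b(y) y)`, for `y ∈ L²` and a control `u = u(x)`. -/
def fpOperator {d : ℕ} (β b : ℝ → ℝ) (D : Rd d → Rd d) (u : Rd d → ℝ) (y : L2 d) : Distr d :=
  -lap (ofFun fun x => u x * β (y x)) + dvg fun i => ofFun fun x => D x i * (b (y x) * y x)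

end FokkerPlanck

end

/-!
The identity `-Δ (I - Δ)⁻¹ = I - (I - Δ)⁻¹` turns the equation, after applying `(I - Δ)⁻¹`, into an
evolution equation for `L²`-valued functions. Let `J : H¹ → L²` be the inclusion and `N` the gradient;
then `(I - Δ)⁻¹ = J J*` on `L²`, and with `r = (I - Δ)⁻¹ ρ ∈ H¹` and `y = ρ ∈ L²` the equation reads
`(J r)' + F(t, y) = 0`, `r = J* y`, where
`F(t, y) = m - J (J* m + ∑ᵢ Nᵢ* qᵢ)`, `m = u(t) β(y)`, `qᵢ = Dᵢ b(y) y`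
(`IsSobolevSpace.VDualToDistr_add_lap_dvg`).

Multiplication by `u ≥ γ₁ > 0` and the bound `β' ≥ α₀ > 0` make the principal part `m` strongly
monotone on `L²`. Both `m` and `q` are Lipschitz in `y`, so the remaining terms, paired with `v`, are
bounded by a multiple of `‖v‖ ‖J* v‖` and cost, by Young's inequality, half of the monotonicity and a
multiple of `‖J* v‖²`, which is the square of the `H⁻¹` norm of `v`. An exponential weight in time
removes the latter (`exists_solution_of_quasiMonotone`).

A Lipschitz strongly monotone equation reduces to the linear equation
`J J* z + κ ∫₀ᵗ z = J r₀ + ∫₀ᵗ g` in `L²(0,T; L²)` by a contraction argument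
(`exists_solution_of_strongMonotone`). The linear equation is solved by duality: the energy identity
`inner_adjoint_evolOp` is an a priori bound for the adjoint operator, and it yields solutions
depending on `g` with Lipschitz constant `κ⁻¹` (`exists_evolOp_section`).
Finally, `exists_continuous_lift` shows that the solution is continuous in time with values in `H⁻¹`.
-/

noncomputable section

namespace FokkerPlanck

open Filter Topology InnerProductSpace

/-! ### Range inclusion for bounded operators -/

section Douglas

variable {X : Type*} [NormedAddCommGroup X] [InnerProductSpace ℝ X] [CompleteSpace X]

/-- If `|⟨p, φ⟩| ≤ C ‖B* φ‖` for all `φ`, then `B y = p` has a solution with `‖y‖ ≤ C`: the functional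
`B* φ ↦ ⟨p, φ⟩` is well defined on the range of `B*`, and `y` represents a Hahn–Banach extension. -/
theorem exists_apply_eq_of_abs_inner_le (B : X →L[ℝ] X) (p : X) (C : ℝ) (hC : 0 ≤ C)
    (h : ∀ φ, |inner ℝ p φ| ≤ C * ‖B.adjoint φ‖) : ∃ y, B y = p ∧ ‖y‖ ≤ C := by
  obtain ⟨g, hg⟩ := (B.adjoint : X →ₗ[ℝ] X).rangeRestrict.exists_rightInverse_of_surjective
    (LinearMap.range_rangeRestrict _)
  have hg' : ∀ x : LinearMap.range (B.adjoint : X →ₗ[ℝ] X), B.adjoint (g x) = x := fun x =>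
    congrArg Subtype.val (LinearMap.congr_fun hg x)
  let f : StrongDual ℝ (LinearMap.range (B.adjoint : X →ₗ[ℝ] X)) :=
    LinearMap.mkContinuous ((innerSL ℝ p : X →ₗ[ℝ] ℝ).comp g) C (fun x => by
      have := h (g x)
      rw [hg'] at this
      simpa using this)
  obtain ⟨F, hF, hFn⟩ := exists_extension_norm_eq _ f
  refine ⟨(toDual ℝ X).symm F, ?_, ?_⟩
  · refine ext_inner_right ℝ fun φ => ?_
    rw [← ContinuousLinearMap.adjoint_inner_right, toDual_symm_apply]
    have h1 := hF ⟨B.adjoint φ, ⟨φ, rfl⟩⟩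
    have h2 := h (g ⟨B.adjoint φ, ⟨φ, rfl⟩⟩ - φ)
    rw [map_sub, hg'] at h2
    simp only [sub_self, norm_zero, mul_zero, inner_sub_right] at h2
    simp only at h1
    rw [h1]
    change inner ℝ p (g ⟨B.adjoint φ, ⟨φ, rfl⟩⟩) = _
    exact sub_eq_zero.1 (abs_eq_zero.1 (le_antisymm h2 (abs_nonneg _)))
  · rw [LinearIsometryEquiv.norm_map, hFn]
    exact LinearMap.mkContinuous_norm_le _ hC _

/-- Douglas' range inclusion in the form used for the linear problem: `‖Q* φ‖ ≤ C ‖B* φ‖` gives a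
`C`-Lipschitz choice `R` of solutions of `B (R g) = Q g`. The solution orthogonal to `ker B` depends
linearly on `g`, and projecting onto `(ker B)ᗮ` does not increase the norm. -/
theorem exists_lipschitz_section (B Q : X →L[ℝ] X) (C : NNReal)
    (h : ∀ φ, ‖Q.adjoint φ‖ ≤ C * ‖B.adjoint φ‖) :
    ∃ R : X → X, (∀ g, B (R g) = Q g) ∧ LipschitzWith C R := by
  have key : ∀ g, ∃ y, B y = Q g ∧ ‖y‖ ≤ C * ‖g‖ := fun g =>
    exists_apply_eq_of_abs_inner_le B (Q g) (C * ‖g‖) (by positivity) fun φ => by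
      rw [← ContinuousLinearMap.adjoint_inner_right]
      calc |inner ℝ g (Q.adjoint φ)| ≤ ‖g‖ * ‖Q.adjoint φ‖ := abs_real_inner_le_norm _ _
        _ ≤ ‖g‖ * (C * ‖B.adjoint φ‖) := by gcongr; exact h φ
        _ = _ := by ring
  choose y hy _ using key
  let K : Submodule ℝ X := LinearMap.ker (B : X →ₗ[ℝ] X)
  have : CompleteSpace K := B.isClosed_ker.completeSpace_coe
  have hB : ∀ x, B (Kᗮ.starProjection x) = B x := fun x => by
    have h1 : K.starProjection x ∈ K := K.starProjection_apply_mem x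
    have h2 := K.starProjection_add_starProjection_orthogonal x
    have h3 : B (K.starProjection x) = 0 := h1
    conv_rhs => rw [← h2, map_add, h3, zero_add]
  have hK : ∀ x, B x = 0 → Kᗮ.starProjection x = 0 := fun x hx => by
    rw [Submodule.starProjection_apply_eq_zero_iff]
    exact K.le_orthogonal_orthogonal hx
  refine ⟨fun g => Kᗮ.starProjection (y g), fun g => by rw [hB, hy], ?_⟩
  refine LipschitzWith.of_dist_le_mul fun g g' => ?_
  obtain ⟨δ, hδ, hδn⟩ : ∃ δ, B δ = Q (g - g') ∧ ‖δ‖ ≤ C * ‖g - g'‖ :=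
    exists_apply_eq_of_abs_inner_le B (Q (g - g')) (C * ‖g - g'‖) (by positivity) fun φ => by
      rw [← ContinuousLinearMap.adjoint_inner_right]
      calc |inner ℝ (g - g') (Q.adjoint φ)| ≤ ‖g - g'‖ * ‖Q.adjoint φ‖ :=
            abs_real_inner_le_norm _ _
        _ ≤ ‖g - g'‖ * (C * ‖B.adjoint φ‖) := by gcongr; exact h φ
        _ = _ := by ring
  have h0 := hK (y g - y g' - δ) (by rw [map_sub, map_sub, hy, hy, hδ, map_sub, sub_self])
  rw [map_sub, map_sub, sub_eq_zero] at h0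
  rw [dist_eq_norm, dist_eq_norm]
  rw [h0]
  exact (Submodule.norm_starProjection_apply_le _ _).trans hδn

end Douglas

/-! ### Absolute continuity and the energy identity -/

/-- Primitives of vector-valued integrable functions are absolutely continuous, by comparison with
the primitive of the norm. -/
theorem absolutelyContinuous_primitive {E : Type*} [NormedAddCommGroup E] [NormedSpace ℝ E]
    {f : ℝ → E} {a b c : ℝ}
    (h : IntervalIntegrable f volume a b) (hc : c ∈ uIcc a b) :
    AbsolutelyContinuousOnInterval (fun x => ∫ v in c..x, f v) a b := by
  have h1 := h.norm.absolutelyContinuousOnInterval_intervalIntegral hc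
  rw [absolutelyContinuousOnInterval_iff] at h1 ⊢
  intro ε hε
  obtain ⟨δ, hδ, H⟩ := h1 ε hε
  refine ⟨δ, hδ, fun I hI hs => lt_of_le_of_lt (Finset.sum_le_sum fun i hi => ?_) (H I hI hs)⟩
  have hmem := hI.1 i hi
  have hsub : ∀ {p q}, p ∈ uIcc a b → q ∈ uIcc a b → IntervalIntegrable f volume p q :=
    fun hp hq => h.mono_set (uIcc_subset_uIcc hp hq)
  rw [dist_comm, dist_eq_norm, dist_comm, Real.dist_eq,
    intervalIntegral.integral_interval_sub_left (hsub hc hmem.2) (hsub hc hmem.1),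
    intervalIntegral.integral_interval_sub_left (hsub hc hmem.2).norm (hsub hc hmem.1).norm]
  exact intervalIntegral.norm_integral_le_abs_integral_norm

theorem absolutelyContinuous_norm_sq {E : Type*} [NormedAddCommGroup E] {f : ℝ → E} {a b : ℝ}
    (hf : AbsolutelyContinuousOnInterval f a b) :
    AbsolutelyContinuousOnInterval (fun t => ‖f t‖ ^ 2) a b := by
  have : AbsolutelyContinuousOnInterval (fun t => ‖f t‖) a b := by
    rw [absolutelyContinuousOnInterval_iff] at hf ⊢
    intro ε hε
    obtain ⟨δ, hδ, H⟩ := hf ε hε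
    refine ⟨δ, hδ, fun I hI hs => lt_of_le_of_lt (Finset.sum_le_sum fun i hi => ?_) (H I hI hs)⟩
    simpa [dist_eq_norm] using abs_norm_sub_norm_le (f (I.2 i).1) (f (I.2 i).2)
  simpa only [pow_two] using! this.mul this

/-- The energy identity `‖x(b)‖² = ‖x(a)‖² + 2 ∫ ⟨x', x⟩` for `x(t) = c + ∫ₐᵗ f`. -/
theorem norm_sq_primitive {E : Type*} [NormedAddCommGroup E] [InnerProductSpace ℝ E]
    [CompleteSpace E] {f : ℝ → E} {a b : ℝ} (h : IntervalIntegrable f volume a b) (c : E) :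
    ‖c + ∫ s in a..b, f s‖ ^ 2 =
      ‖c‖ ^ 2 + 2 * ∫ t in a..b, inner ℝ (f t) (c + ∫ s in a..t, f s) := by
  have hac : AbsolutelyContinuousOnInterval (fun t => c + ∫ s in a..t, f s) a b :=
    (LipschitzWith.const c).lipschitzOnWith.absolutelyContinuousOnInterval.add
      (absolutelyContinuous_primitive h (by simp))
  have h1 := (absolutelyContinuous_norm_sq hac).integral_deriv_eq_sub
  simp only [intervalIntegral.integral_same, add_zero] at h1
  have h2 : ∫ t in a..b, deriv (fun t => ‖c + ∫ s in a..t, f s‖ ^ 2) t =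
      ∫ t in a..b, 2 * inner ℝ (f t) (c + ∫ s in a..t, f s) := by
    apply intervalIntegral.integral_congr_ae
    filter_upwards [h.ae_hasDerivAt_integral] with t ht hmem
    have h3 := (ht (uIoc_subset_uIcc hmem) a (by simp)).const_add c
    rw [h3.norm_sq.deriv, real_inner_comm]
  rw [h2, intervalIntegral.integral_const_mul] at h1
  linarith

/-! ### The Volterra operator and the linear problem -/

section Volterra

variable {E : Type*} [NormedAddCommGroup E]

/-- The Bochner space `L²(0,T; E)`. -/
abbrev L2t (E : Type*) [NormedAddCommGroup E] (T : ℝ) := Lp E 2 (volume.restrict (Ioc (0 : ℝ) T))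

theorem intervalIntegrable_L2t {T : ℝ} (hT : 0 ≤ T) (h : L2t E T) :
    IntervalIntegrable h volume 0 T :=
  (intervalIntegrable_iff_integrableOn_Ioc_of_le hT).2 ((Lp.memLp h).integrable one_le_two)

theorem integral_norm_L2t_le {T : ℝ} (h : L2t E T) :
    ∫ t in Ioc 0 T, ‖h t‖ ≤ √(volume.real (Ioc 0 T)) * ‖h‖ := by
  have h1 := eLpNorm_le_eLpNorm_mul_rpow_measure_univ (μ := volume.restrict (Ioc (0 : ℝ) T))
    (one_le_two : (1 : ℝ≥0∞) ≤ 2) (Lp.aestronglyMeasurable h)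
  have h2 := ENNReal.toReal_mono (ENNReal.mul_ne_top (Lp.eLpNorm_ne_top h) (by simp; intro _; norm_num)) h1
  rw [ENNReal.toReal_mul, ← Lp.norm_def, mul_comm] at h2
  rw [integral_norm_eq_lintegral_enorm (Lp.aestronglyMeasurable h),
    ← eLpNorm_one_eq_lintegral_enorm]
  refine h2.trans (le_of_eq ?_)
  have h3 : (1 / ENNReal.toReal 1 - 1 / ENNReal.toReal 2 : ℝ) = 1 / 2 := by norm_num
  rw [Real.sqrt_eq_rpow, ← ENNReal.toReal_rpow, Measure.restrict_apply_univ, Measure.real, h3]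

variable [NormedSpace ℝ E]

theorem continuousOn_primitive_L2t {T : ℝ} (hT : 0 ≤ T) (h : L2t E T) :
    ContinuousOn (fun t => ∫ s in (0 : ℝ)..t, h s) (Icc 0 T) := by
  have := intervalIntegral.continuousOn_primitive_interval (a := 0) (b := T) (μ := volume) (f := h)
    (by rw [uIcc_of_le hT, integrableOn_Icc_iff_integrableOn_Ioc]
        exact (Lp.memLp h).integrable one_le_two)
  rwa [uIcc_of_le hT] at this

theorem norm_primitive_L2t_le {T t : ℝ} (ht : t ∈ Icc 0 T) (h : L2t E T) :
    ‖∫ s in (0 : ℝ)..t, h s‖ ≤ √(volume.real (Ioc 0 T)) * ‖h‖ := by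
  refine le_trans ?_ (integral_norm_L2t_le h)
  rw [intervalIntegral.integral_of_le ht.1]
  refine (norm_integral_le_integral_norm _).trans ?_
  refine setIntegral_mono_set ((Lp.memLp h).integrable one_le_two).norm ?_ ?_
  · exact Eventually.of_forall fun _ => norm_nonneg _
  · exact (Ioc_subset_Ioc_right ht.2).eventuallyLE

theorem memLp_primitive_L2t {T : ℝ} (hT : 0 ≤ T) (h : L2t E T) :
    MemLp (fun t => ∫ s in (0 : ℝ)..t, h s) 2 (volume.restrict (Ioc 0 T)) := by
  refine MemLp.of_bound (((continuousOn_primitive_L2t hT h).mono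
    Ioc_subset_Icc_self).aestronglyMeasurable measurableSet_Ioc)
    (√(volume.real (Ioc 0 T)) * ‖h‖) ?_
  filter_upwards [ae_restrict_mem measurableSet_Ioc] with t ht
  exact norm_primitive_L2t_le (Ioc_subset_Icc_self ht) h

/-- The Volterra operator `(P h)(t) = ∫₀ᵗ h(s) ds` on `L²(0,T; E)`. -/
def volterra (E : Type*) [NormedAddCommGroup E] [NormedSpace ℝ E] {T : ℝ} (hT : 0 ≤ T) :
    L2t E T →L[ℝ] L2t E T :=
  LinearMap.mkContinuous
    { toFun := fun h => (memLp_primitive_L2t hT h).toLp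
      map_add' := fun h g => by
        rw [← MemLp.toLp_add]
        refine MemLp.toLp_congr _ _ ?_
        filter_upwards [ae_restrict_mem measurableSet_Ioc] with t ht
        have hs : ∀ f : L2t E T, IntervalIntegrable f volume 0 t := fun f =>
          (intervalIntegrable_L2t hT f).mono_set
            (uIcc_subset_uIcc_left (by rw [uIcc_of_le hT]; exact Ioc_subset_Icc_self ht))
        rw [Pi.add_apply, ← intervalIntegral.integral_add (hs h) (hs g)]
        rw [intervalIntegral.integral_of_le ht.1.le, intervalIntegral.integral_of_le ht.1.le]
        refine integral_congr_ae ?_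
        exact ae_restrict_of_ae_restrict_of_subset (Ioc_subset_Ioc_right ht.2)
          (Lp.coeFn_add h g)
      map_smul' := fun c h => by
        rw [RingHom.id_apply, ← MemLp.toLp_const_smul]
        refine MemLp.toLp_congr _ _ ?_
        filter_upwards [ae_restrict_mem measurableSet_Ioc] with t ht
        rw [Pi.smul_apply, ← intervalIntegral.integral_smul]
        rw [intervalIntegral.integral_of_le ht.1.le, intervalIntegral.integral_of_le ht.1.le]
        refine integral_congr_ae ?_
        exact ae_restrict_of_ae_restrict_of_subset (Ioc_subset_Ioc_right ht.2)
          (Lp.coeFn_smul c h) }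
    ((volume.restrict (Ioc (0 : ℝ) T)).real univ ^ (2 : ℝ≥0∞).toReal⁻¹ *
      √(volume.real (Ioc 0 T))) (fun h => by
      rw [mul_assoc]
      refine Lp.norm_le_of_ae_bound (by positivity) ?_
      filter_upwards [ae_restrict_mem measurableSet_Ioc,
        (memLp_primitive_L2t hT h).coeFn_toLp] with t ht h2
      simp only [LinearMap.coe_mk, AddHom.coe_mk]
      rw [h2]
      exact norm_primitive_L2t_le (Ioc_subset_Icc_self ht) h)

theorem volterra_apply {T : ℝ} (hT : 0 ≤ T) (h : L2t E T) :
    ∀ᵐ t ∂volume.restrict (Ioc 0 T), volterra E hT h t = ∫ s in (0 : ℝ)..t, h s :=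
  (memLp_primitive_L2t hT h).coeFn_toLp

end Volterra

theorem inner_L2t {V : Type*} [NormedAddCommGroup V] [InnerProductSpace ℝ V] {T : ℝ} (hT : 0 ≤ T) (f g : L2t V T) :
    inner ℝ f g = ∫ t in (0 : ℝ)..T, inner ℝ (f t) (g t) := by
  rw [L2.inner_def, intervalIntegral.integral_of_le hT]

section Linear

variable {V W : Type*} [NormedAddCommGroup V] [InnerProductSpace ℝ V] [CompleteSpace V]
  [NormedAddCommGroup W] [InnerProductSpace ℝ W] [CompleteSpace W]

/-- The operator `G + κ P` on `L²(0,T; V)`, with `G = J J*` acting pointwise in time. -/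
def evolOp (J : W →L[ℝ] V) {T : ℝ} (hT : 0 ≤ T) (κ : ℝ) : L2t V T →L[ℝ] L2t V T :=
  (J ∘L J.adjoint).compLpL 2 _ + κ • volterra V hT

theorem inner_volterra_gram (J : W →L[ℝ] V) {T : ℝ} (hT : 0 ≤ T) (φ : L2t V T) :
    inner ℝ (volterra V hT ((J ∘L J.adjoint).compLpL 2 _ φ)) φ =
      ‖∫ t in (0 : ℝ)..T, J.adjoint (φ t)‖ ^ 2 / 2 := by
  have hi : IntervalIntegrable (fun t => J.adjoint (φ t)) volume 0 T := by
    refine (intervalIntegrable_iff_integrableOn_Ioc_of_le hT).2 ?_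
    exact J.adjoint.integrable_comp ((Lp.memLp φ).integrable one_le_two)
  have h1 := norm_sq_primitive hi 0
  simp only [zero_add, norm_zero] at h1
  rw [h1, inner_L2t hT]
  simp only [ne_eq, OfNat.ofNat_ne_zero, not_false_eq_true, zero_pow, zero_add]
  rw [mul_div_cancel_left₀ _ (two_ne_zero)]
  apply intervalIntegral.integral_congr_ae_restrict
  rw [uIoc_of_le hT]
  filter_upwards [volterra_apply hT ((J ∘L J.adjoint).compLpL 2 _ φ),
    ae_restrict_mem measurableSet_Ioc] with t ht htm
  have hsub : uIcc 0 t ⊆ uIcc 0 T := by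
    refine uIcc_subset_uIcc_left ?_
    rw [uIcc_of_le hT]; exact Ioc_subset_Icc_self htm
  rw [ht]
  have h2 : ∫ s in (0 : ℝ)..t, ((J ∘L J.adjoint).compLpL 2 (volume.restrict (Ioc 0 T)) φ) s =
      J (∫ s in (0 : ℝ)..t, J.adjoint (φ s)) := by
    rw [← ContinuousLinearMap.intervalIntegral_comp_comm _ (hi.mono_set hsub)]
    rw [intervalIntegral.integral_of_le htm.1.le, intervalIntegral.integral_of_le htm.1.le]
    refine integral_congr_ae ?_
    exact ae_restrict_of_ae_restrict_of_subset (Ioc_subset_Ioc_right htm.2)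
      ((J ∘L J.adjoint).coeFn_compLpL φ)
  rw [h2, real_inner_comm, ContinuousLinearMap.adjoint_inner_left]

theorem inner_gram_L2t (J : W →L[ℝ] V) {T : ℝ} (φ ψ : L2t V T) :
    inner ℝ ((J ∘L J.adjoint).compLpL 2 _ φ) ψ =
      inner ℝ φ ((J ∘L J.adjoint).compLpL 2 _ ψ) := by
  rw [L2.inner_def, L2.inner_def]
  refine integral_congr_ae ?_
  filter_upwards [(J ∘L J.adjoint).coeFn_compLpL φ, (J ∘L J.adjoint).coeFn_compLpL ψ] with t h1 h2
  rw [h1, h2]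
  simp only [ContinuousLinearMap.comp_apply]
  rw [← ContinuousLinearMap.adjoint_inner_right, ContinuousLinearMap.adjoint_inner_left]

/-- The energy identity behind the linear theory: with `B = G + κ P`,
`⟨B* φ, P* φ⟩ = ½ ‖∫ J* φ‖² + κ ‖P* φ‖²`. It gives both a priori bounds needed to invert `B`. -/
theorem inner_adjoint_evolOp (J : W →L[ℝ] V) {T : ℝ} (hT : 0 ≤ T) (κ : ℝ) (φ : L2t V T) :
    inner ℝ ((evolOp J hT κ).adjoint φ) ((volterra V hT).adjoint φ) =
      ‖∫ t in (0 : ℝ)..T, J.adjoint (φ t)‖ ^ 2 / 2 + κ * ‖(volterra V hT).adjoint φ‖ ^ 2 := by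
  rw [ContinuousLinearMap.adjoint_inner_left, evolOp, add_apply,
    inner_add_right, smul_apply, inner_smul_right,
    ← ContinuousLinearMap.adjoint_inner_left (volterra V hT), real_inner_self_eq_norm_sq,
    ← inner_gram_L2t J, ContinuousLinearMap.adjoint_inner_right, inner_volterra_gram]

theorem norm_adjoint_volterra_le (J : W →L[ℝ] V) {T : ℝ} (hT : 0 ≤ T) {κ : ℝ} (hκ : 0 < κ)
    (φ : L2t V T) :
    ‖(volterra V hT).adjoint φ‖ ≤ κ⁻¹ * ‖(evolOp J hT κ).adjoint φ‖ := by
  have h1 := inner_adjoint_evolOp J hT κ φ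
  have h2 := real_inner_le_norm ((evolOp J hT κ).adjoint φ) ((volterra V hT).adjoint φ)
  rcases (norm_nonneg ((volterra V hT).adjoint φ)).eq_or_lt with h | h
  · rw [← h]; positivity
  rw [← mul_le_mul_iff_of_pos_right h, inv_mul_eq_div, div_mul_eq_mul_div, le_div_iff₀ hκ]
  nlinarith [sq_nonneg ‖∫ t in (0 : ℝ)..T, J.adjoint (φ t)‖]

/-- Linear problem with zero initial value: `G z + κ ∫₀ᵗ z = ∫₀ᵗ g` has a solution `z = R g` which is
`κ⁻¹`-Lipschitz in `g`. The constant is the same as for the equation `κ z = g` without `G`. -/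
theorem exists_evolOp_section (J : W →L[ℝ] V) {T : ℝ} (hT : 0 ≤ T) {κ : ℝ} (hκ : 0 < κ) :
    ∃ R : L2t V T → L2t V T, (∀ g, evolOp J hT κ (R g) = volterra V hT g) ∧
      LipschitzWith (Real.toNNReal κ⁻¹) R :=
  exists_lipschitz_section _ _ _ fun φ => by
    rw [Real.coe_toNNReal _ (by positivity)]
    exact norm_adjoint_volterra_le J hT hκ φ

/-- Linear problem with initial value `r ∈ W` and zero right-hand side: `G z + κ ∫₀ᵗ z = J r`. -/
theorem exists_evolOp_eq_const (J : W →L[ℝ] V) {T : ℝ} (hT : 0 ≤ T) {κ : ℝ} (hκ : 0 < κ) (r : W) :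
    ∃ z : L2t V T, ∀ᵐ t ∂volume.restrict (Ioc 0 T), evolOp J hT κ z t = J r := by
  have hc : MemLp (fun _ : ℝ => J r) 2 (volume.restrict (Ioc 0 T)) := memLp_const _
  obtain ⟨z, hz, -⟩ := exists_apply_eq_of_abs_inner_le (evolOp J hT κ) hc.toLp (‖r‖ * √(2 * κ⁻¹))
    (by positivity) fun φ => by
      have h0 : inner ℝ hc.toLp φ = inner ℝ r (∫ t in (0 : ℝ)..T, J.adjoint (φ t)) := by
        have hi : IntervalIntegrable (fun t => J.adjoint (φ t)) volume 0 T := by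
          refine (intervalIntegrable_iff_integrableOn_Ioc_of_le hT).2 ?_
          exact J.adjoint.integrable_comp ((Lp.memLp φ).integrable one_le_two)
        rw [inner_L2t hT, ← innerSL_apply_apply ℝ, ← ContinuousLinearMap.intervalIntegral_comp_comm _ hi]
        apply intervalIntegral.integral_congr_ae_restrict
        rw [uIoc_of_le hT]
        filter_upwards [hc.coeFn_toLp] with t ht
        rw [ht, innerSL_apply_apply, ContinuousLinearMap.adjoint_inner_right]
      rw [h0, mul_assoc]
      refine (abs_real_inner_le_norm _ _).trans (mul_le_mul_of_nonneg_left ?_ (norm_nonneg _))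
      refine abs_le_of_sq_le_sq' ?_ (by positivity) |>.2
      rw [mul_pow, Real.sq_sqrt (by positivity)]
      have h1 := inner_adjoint_evolOp J hT κ φ
      have h2 := real_inner_le_norm ((evolOp J hT κ).adjoint φ) ((volterra V hT).adjoint φ)
      have h3 := norm_adjoint_volterra_le J hT hκ φ
      have h4 := mul_le_mul_of_nonneg_left h3 (norm_nonneg ((evolOp J hT κ).adjoint φ))
      nlinarith [mul_nonneg hκ.le (sq_nonneg ‖(volterra V hT).adjoint φ‖)]
  refine ⟨z, ?_⟩
  rw [hz]
  exact hc.coeFn_toLp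

end Linear

/-! ### Resolvent approximation and continuity in the intermediate space -/

section Resolvent

/-- Uniformly bounded operators that tend to `0` on a dense set tend to `0` everywhere. -/
theorem tendsto_zero_of_denseRange {ι E F : Type*} [NormedAddCommGroup E] [NormedSpace ℝ E]
    [NormedAddCommGroup F] [NormedSpace ℝ F] {A : ℕ → E →L[ℝ] F} {C : ℝ}
    (hA : ∀ n v, ‖A n v‖ ≤ C * ‖v‖) {f : ι → E} (hf : DenseRange f)
    (h : ∀ i, Tendsto (fun n => A n (f i)) atTop (𝓝 0)) (v : E) :
    Tendsto (fun n => A n v) atTop (𝓝 0) := by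
  rw [Metric.tendsto_atTop]
  intro ε hε
  obtain ⟨i, hi⟩ := Metric.denseRange_iff.1 hf v (ε / (2 * (|C| + 1))) (by positivity)
  obtain ⟨N, hN⟩ := Metric.tendsto_atTop.1 (h i) (ε / 2) (by positivity)
  refine ⟨N, fun n hn => ?_⟩
  have h1 := hN n hn
  rw [dist_zero_right] at h1 ⊢
  have h2 : A n v = A n (v - f i) + A n (f i) := by rw [map_sub]; abel
  have h3 : ‖A n (v - f i)‖ ≤ ε / 2 := by
    rw [dist_eq_norm] at hi
    calc ‖A n (v - f i)‖ ≤ C * ‖v - f i‖ := hA _ _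
      _ ≤ (|C| + 1) * (ε / (2 * (|C| + 1))) := by
        gcongr
        linarith [le_abs_self C]
      _ = ε / 2 := by field_simp
  rw [h2]
  linarith [norm_add_le (A n (v - f i)) (A n (f i))]

variable {V W : Type*} [NormedAddCommGroup V] [InnerProductSpace ℝ V] [CompleteSpace V]
  [NormedAddCommGroup W] [InnerProductSpace ℝ W] [CompleteSpace W]

theorem inner_gram_self (J : W →L[ℝ] V) (v : V) :
    inner ℝ (J (J.adjoint v)) v = ‖J.adjoint v‖ ^ 2 := by
  rw [← ContinuousLinearMap.adjoint_inner_right, real_inner_self_eq_norm_sq]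

/-- The resolvent `(G + c)⁻¹` of `G = J J*`, for `c > 0`, by Lax–Milgram. -/
theorem exists_gram_resolvent (J : W →L[ℝ] V) {c : ℝ} (hc : 0 < c) :
    ∃ Q : V →L[ℝ] V, (∀ v, J (J.adjoint (Q v)) + c • Q v = v) ∧
      ∀ v, Q (J (J.adjoint v)) + c • Q v = v := by
  let A : V →L[ℝ] V := J ∘L J.adjoint + c • ContinuousLinearMap.id ℝ V
  have hA : ∀ v, A v = J (J.adjoint v) + c • v := fun v => rfl
  have hco : IsCoercive ((innerSL ℝ).comp A : V →L[ℝ] V →L[ℝ] ℝ) := by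
    refine ⟨c, hc, fun v => ?_⟩
    change _ ≤ inner ℝ (A v) v
    rw [hA, inner_add_left, inner_gram_self, real_inner_smul_left, real_inner_self_eq_norm_sq]
    nlinarith [sq_nonneg ‖J.adjoint v‖]
  have he : ∀ v, hco.continuousLinearEquivOfBilin v = A v := fun v =>
    ext_inner_right ℝ fun w => hco.continuousLinearEquivOfBilin_apply v w
  refine ⟨hco.continuousLinearEquivOfBilin.symm, fun v => ?_, fun v => ?_⟩
  · rw [← hA]
    change A (hco.continuousLinearEquivOfBilin.symm v) = v
    rw [← he, ContinuousLinearEquiv.apply_symm_apply]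
  · rw [← map_smul, ← map_add, ← hA, ← he]
    exact ContinuousLinearEquiv.symm_apply_apply _ _

theorem norm_sq_gram_add (J : W →L[ℝ] V) (c : ℝ) (x : V) :
    ‖J (J.adjoint x) + c • x‖ ^ 2 =
      ‖J (J.adjoint x)‖ ^ 2 + 2 * c * ‖J.adjoint x‖ ^ 2 + ‖c • x‖ ^ 2 := by
  rw [norm_add_sq_real, real_inner_smul_right, inner_gram_self]
  ring

/-- Bounded approximations `Qₙ = (G + 1/(n+1))⁻¹` of the unbounded inverse of `G = J J*`: they commute
with `G`, the contractions `G Qₙ` tend to the identity of `V`, and `J* Qₙ J` to the identity of `W`. -/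
theorem exists_gram_approx (J : W →L[ℝ] V) (hJ : DenseRange J) (hJ' : DenseRange J.adjoint) :
    ∃ Q : ℕ → V →L[ℝ] V, (∀ n v, Q n (J (J.adjoint v)) = J (J.adjoint (Q n v))) ∧
      (∀ n v, ‖J (J.adjoint (Q n v))‖ ≤ ‖v‖) ∧
      (∀ v, Tendsto (fun n => J (J.adjoint (Q n v))) atTop (𝓝 v)) ∧
      ∀ r, Tendsto (fun n => J.adjoint (Q n (J r))) atTop (𝓝 r) := by
  let c : ℕ → ℝ := fun n => 1 / ((n : ℝ) + 1)
  have hc : ∀ n, 0 < c n := fun n => by positivity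
  have hc0 : Tendsto c atTop (𝓝 0) := tendsto_one_div_add_atTop_nhds_zero_nat
  choose Q h1 h2 using fun n => exists_gram_resolvent J (hc n)
  have hcomm : ∀ n v, Q n (J (J.adjoint v)) = J (J.adjoint (Q n v)) := fun n v =>
    add_right_cancel ((h2 n v).trans (h1 n v).symm)
  have hsq : ∀ n v, ‖v‖ ^ 2 = ‖J (J.adjoint (Q n v))‖ ^ 2 + 2 * c n * ‖J.adjoint (Q n v)‖ ^ 2 +
      ‖c n • Q n v‖ ^ 2 := fun n v => by rw [← norm_sq_gram_add, h1]
  have hb1 : ∀ n v, ‖J (J.adjoint (Q n v))‖ ≤ ‖v‖ := fun n v => by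
    refine abs_le_of_sq_le_sq' ?_ (norm_nonneg _) |>.2
    have := hsq n v
    have := mul_nonneg (hc n).le (sq_nonneg ‖J.adjoint (Q n v)‖)
    nlinarith [sq_nonneg ‖c n • Q n v‖]
  have hb2 : ∀ n v, ‖c n • Q n v‖ ≤ ‖v‖ := fun n v => by
    refine abs_le_of_sq_le_sq' ?_ (norm_nonneg _) |>.2
    have := hsq n v
    have := mul_nonneg (hc n).le (sq_nonneg ‖J.adjoint (Q n v)‖)
    nlinarith [sq_nonneg ‖J (J.adjoint (Q n v))‖]
  -- `‖J* Qₙ J r‖² ≤ ⟨(G + cₙ) Qₙ J r, Qₙ J r⟩ = ⟨r, J* Qₙ J r⟩`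
  have hb3 : ∀ n r, ‖J.adjoint (Q n (J r))‖ ≤ ‖r‖ := fun n r => by
    rcases (norm_nonneg (J.adjoint (Q n (J r)))).eq_or_lt with h | h
    · rw [← h]; positivity
    refine le_of_mul_le_mul_left ?_ h
    have e1 : inner ℝ (J (J.adjoint (Q n (J r))) + c n • Q n (J r)) (Q n (J r)) =
        inner ℝ (J r) (Q n (J r)) := by rw [h1]
    rw [inner_add_left, inner_gram_self, real_inner_smul_left, real_inner_self_eq_norm_sq,
      ← ContinuousLinearMap.adjoint_inner_right] at e1
    have e2 := real_inner_le_norm r (J.adjoint (Q n (J r)))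
    have := mul_nonneg (hc n).le (sq_nonneg ‖Q n (J r)‖)
    nlinarith
  -- on the dense range of `G`, `cₙ Qₙ G x = cₙ G Qₙ x` has norm at most `cₙ ‖x‖`
  have hz : ∀ v, Tendsto (fun n => (c n • Q n) v) atTop (𝓝 0) := by
    refine tendsto_zero_of_denseRange (C := 1) (fun n v => by simpa using hb2 n v)
      (hJ.comp hJ' J.continuous) fun x => ?_
    refine squeeze_zero_norm (a := fun n => c n * ‖x‖) (fun n => ?_) (by simpa using hc0.mul_const ‖x‖)
    rw [Function.comp_apply, smul_apply, hcomm, norm_smul, Real.norm_of_nonneg (hc n).le]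
    exact mul_le_mul_of_nonneg_left (hb1 n x) (hc n).le
  refine ⟨Q, hcomm, hb1, fun v => ?_, fun r => ?_⟩
  · have : (fun n => J (J.adjoint (Q n v))) = fun n => v - (c n • Q n) v := by
      funext n
      rw [smul_apply, eq_sub_iff_add_eq, h1]
    rw [this]
    simpa using (hz v).const_sub v
  · have h4 := tendsto_zero_of_denseRange (C := 2) (A := fun n => ContinuousLinearMap.id ℝ W -
      (J.adjoint ∘L Q n ∘L J)) (fun n r => by
        have := norm_sub_le r (J.adjoint (Q n (J r)))
        have := hb3 n r
        simp only [sub_apply, ContinuousLinearMap.id_apply, ContinuousLinearMap.comp_apply]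
        linarith) hJ' (fun x => by
        have h5 := (J.adjoint.continuous.tendsto 0).comp (hz x)
        rw [map_zero] at h5
        refine h5.congr fun n => ?_
        simp only [sub_apply, ContinuousLinearMap.id_apply, ContinuousLinearMap.comp_apply,
          Function.comp_apply]
        rw [← map_sub]
        congr 1
        rw [smul_apply, eq_sub_iff_add_eq, add_comm, h2]) r
    have h6 := h4.const_sub r
    simpa using h6

end Resolvent

theorem tendsto_integral_norm_sq_sub {V : Type*} [NormedAddCommGroup V] [InnerProductSpace ℝ V] {T : ℝ} {A : ℕ → V →L[ℝ] V} (hA : ∀ n v, ‖A n v‖ ≤ ‖v‖)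
    (h : ∀ v, Tendsto (fun n => A n v) atTop (𝓝 v)) (f : L2t V T) :
    Tendsto (fun n => ∫ t in Ioc 0 T, ‖A n (f t) - f t‖ ^ 2) atTop (𝓝 0) := by
  suffices Tendsto (fun n => ∫ t in Ioc 0 T, ‖A n (f t) - f t‖ ^ 2) atTop
      (𝓝 (∫ _ in Ioc (0 : ℝ) T, (0 : ℝ))) by rwa [integral_zero] at this
  refine tendsto_integral_of_dominated_convergence (fun t => 4 * ‖f t‖ ^ 2) (fun n => ?_) ?_
    (fun n => Eventually.of_forall fun t => ?_) (Eventually.of_forall fun t => ?_)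
  · exact ((((A n).continuous.comp_aestronglyMeasurable (Lp.aestronglyMeasurable f)).sub
      (Lp.aestronglyMeasurable f)).norm).pow 2
  · exact ((Lp.memLp f).integrable_norm_pow (p := 2) two_ne_zero).const_mul 4
  · rw [Real.norm_of_nonneg (by positivity)]
    have := norm_sub_le (A n (f t)) (f t)
    have := hA n (f t)
    nlinarith [norm_nonneg (A n (f t) - f t)]
  · have h2 := ((h (f t)).sub_const (f t)).norm.pow 2
    simpa using h2

theorem integrable_norm_sq_sub {V : Type*} [NormedAddCommGroup V] [InnerProductSpace ℝ V] {T : ℝ} (A : V →L[ℝ] V) (f : L2t V T) :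
    Integrable (fun t => ‖A (f t) - f t‖ ^ 2) (volume.restrict (Ioc 0 T)) := by
  have h : MemLp (fun t => A (f t) - f t) 2 (volume.restrict (Ioc 0 T)) :=
    (A.comp_memLp f).sub (Lp.memLp f)
  exact h.integrable_norm_pow (p := 2) two_ne_zero

section LionsMagenes

variable {V W : Type*} [NormedAddCommGroup V] [InnerProductSpace ℝ V] [CompleteSpace V]
  [NormedAddCommGroup W] [InnerProductSpace ℝ W] [CompleteSpace W]

/-- If `G y = J r₀ + ∫₀ᵗ h` with `y, h ∈ L²(0,T; V)`, then `J* y` has a representative in `C([0,T]; W)`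
(a form of the Lions–Magenes lemma). The functions `J* Qₙ w`, where `w` is the right-hand side, are
primitives, and the energy identity for their differences shows that they are uniformly Cauchy. -/
theorem exists_continuous_lift (J : W →L[ℝ] V) (hJ : DenseRange J) (hJ' : DenseRange J.adjoint)
    {T : ℝ} (hT : 0 ≤ T) (y h : L2t V T) (r₀ : W)
    (H : ∀ᵐ t ∂volume.restrict (Ioc 0 T),
      J (J.adjoint (y t)) = J r₀ + ∫ s in (0 : ℝ)..t, h s) :
    ∃ r : ℝ → W, ContinuousOn r (Icc 0 T) ∧ r 0 = r₀ ∧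
      (∀ t ∈ Icc 0 T, J (r t) = J r₀ + ∫ s in (0 : ℝ)..t, h s) ∧
      ∀ᵐ t ∂volume.restrict (Ioc 0 T), r t = J.adjoint (y t) := by
  obtain ⟨Q, hcomm, hb, hlim, hlim'⟩ := exists_gram_approx J hJ hJ'
  let w : ℝ → V := fun t => J r₀ + ∫ s in (0 : ℝ)..t, h s
  have hw0 : w 0 = J r₀ := by simp [w]
  have hwc : ContinuousOn w (Icc 0 T) := continuousOn_const.add (continuousOn_primitive_L2t hT h)
  let rr : ℕ → ℝ → W := fun n t => J.adjoint (Q n (w t))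
  let A : ℕ → V →L[ℝ] V := fun n => J ∘L J.adjoint ∘L Q n
  have hAt : ∀ f : L2t V T, Tendsto (fun n => ∫ t in Ioc 0 T, ‖A n (f t) - f t‖ ^ 2) atTop (𝓝 0) :=
    fun f => tendsto_integral_norm_sq_sub hb hlim f
  let b : ℕ → ℝ := fun n => 2 * ‖rr n 0 - r₀‖ ^ 2 +
    (2 * (∫ t in Ioc 0 T, ‖A n (h t) - h t‖ ^ 2) + 2 * ∫ t in Ioc 0 T, ‖A n (y t) - y t‖ ^ 2)
  have hb0 : Tendsto b atTop (𝓝 0) := by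
    have e1 : Tendsto (fun n => rr n 0) atTop (𝓝 r₀) := by
      simp only [rr, hw0]; exact hlim' r₀
    have e2 := (((e1.sub_const r₀).norm.pow 2).const_mul 2).add
      (((hAt h).const_mul 2).add ((hAt y).const_mul 2))
    simpa using e2
  -- with `D = J* (Qₙ - Qₘ)` and `w = G y` a.e., the integrand `⟨D h, D w⟩` of the energy identity is
  -- `⟨(G Qₙ - G Qₘ) h, (G Qₙ - G Qₘ) y⟩`
  have key : ∀ n m, ∀ t ∈ Icc 0 T, ‖rr n t - rr m t‖ ^ 2 ≤ b n + b m := by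
    intro n m t ht
    let D : V →L[ℝ] W := J.adjoint ∘L (Q n - Q m)
    have hsub : uIcc 0 t ⊆ uIcc 0 T := by
      refine uIcc_subset_uIcc_left ?_
      rw [uIcc_of_le hT]; exact ht
    have hi : ∀ {s}, s ∈ Icc 0 T → IntervalIntegrable h volume 0 s := fun hs =>
      (intervalIntegrable_L2t hT h).mono_set (uIcc_subset_uIcc_left (by rwa [uIcc_of_le hT]))
    have hDi : IntervalIntegrable (fun s => D (h s)) volume 0 t :=
      ⟨D.integrable_comp (hi ht).1, D.integrable_comp (hi ht).2⟩
    have hD : ∀ s ∈ Icc 0 T, rr n s - rr m s = D (J r₀) + ∫ τ in (0 : ℝ)..s, D (h τ) := by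
      intro s hs
      rw [ContinuousLinearMap.intervalIntegral_comp_comm _ (hi hs), ← map_add]
      simp [rr, D, w]
    have e1 := norm_sq_primitive hDi (D (J r₀))
    rw [← hD t ht] at e1
    have e2 : ∫ s in (0 : ℝ)..t, inner ℝ (D (h s)) (D (J r₀) + ∫ τ in (0 : ℝ)..s, D (h τ)) ≤
        ∫ s in Ioc 0 T, (‖A n (h s) - h s‖ ^ 2 + ‖A m (h s) - h s‖ ^ 2 +
          (‖A n (y s) - y s‖ ^ 2 + ‖A m (y s) - y s‖ ^ 2)) := by
      have hint := ((integrable_norm_sq_sub (A n) h).add (integrable_norm_sq_sub (A m) h)).add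
          ((integrable_norm_sq_sub (A n) y).add (integrable_norm_sq_sub (A m) y))
      rw [intervalIntegral.integral_of_le ht.1]
      refine le_trans ?_ (setIntegral_mono_set hint
        (Eventually.of_forall fun s => by simp only [Pi.zero_apply]; positivity)
        (Ioc_subset_Ioc_right ht.2).eventuallyLE)
      -- a non-integrable left-hand side has integral `0`, and the bound is trivial
      by_cases hli : IntegrableOn (fun s => (inner ℝ (D (h s))
          (D (J r₀) + ∫ τ in (0 : ℝ)..s, D (h τ)) : ℝ)) (Ioc 0 t)
      swap
      · rw [integral_undef hli]
        exact integral_nonneg fun s => by positivity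
      refine integral_mono_ae hli (hint.mono_measure
        (Measure.restrict_mono_set _ (Ioc_subset_Ioc_right ht.2))) ?_
      filter_upwards [ae_restrict_of_ae_restrict_of_subset (Ioc_subset_Ioc_right ht.2) H,
        ae_restrict_mem measurableSet_Ioc] with s hs hsm
      rw [← hD s ⟨hsm.1.le, hsm.2.trans ht.2⟩]
      have f1 : rr n s - rr m s = J.adjoint (A n (y s) - A m (y s)) := by
        simp only [rr, w, A]
        rw [← hs, hcomm, hcomm]
        simp
      have f2 : J (D (h s)) = A n (h s) - A m (h s) := by simp [D, A]
      rw [f1, ContinuousLinearMap.adjoint_inner_right, f2]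
      have g1 := real_inner_le_norm (A n (h s) - A m (h s)) (A n (y s) - A m (y s))
      have g2 := norm_sub_le (A n (h s) - h s) (A m (h s) - h s)
      have g3 := norm_sub_le (A n (y s) - y s) (A m (y s) - y s)
      rw [sub_sub_sub_cancel_right] at g2 g3
      have g4 := mul_le_mul g2 g3 (norm_nonneg _) (by positivity)
      nlinarith [sq_nonneg (‖A n (h s) - h s‖ - ‖A n (y s) - y s‖),
        sq_nonneg (‖A n (h s) - h s‖ - ‖A m (y s) - y s‖),
        sq_nonneg (‖A m (h s) - h s‖ - ‖A n (y s) - y s‖),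
        sq_nonneg (‖A m (h s) - h s‖ - ‖A m (y s) - y s‖)]
    have e3 : ∫ s in Ioc 0 T, (‖A n (h s) - h s‖ ^ 2 + ‖A m (h s) - h s‖ ^ 2 +
          (‖A n (y s) - y s‖ ^ 2 + ‖A m (y s) - y s‖ ^ 2)) =
        (∫ s in Ioc 0 T, ‖A n (h s) - h s‖ ^ 2) + (∫ s in Ioc 0 T, ‖A m (h s) - h s‖ ^ 2) +
        ((∫ s in Ioc 0 T, ‖A n (y s) - y s‖ ^ 2) + ∫ s in Ioc 0 T, ‖A m (y s) - y s‖ ^ 2) := by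
      rw [integral_add, integral_add, integral_add]
      · exact integrable_norm_sq_sub _ _
      · exact integrable_norm_sq_sub _ _
      · exact integrable_norm_sq_sub _ _
      · exact integrable_norm_sq_sub _ _
      · exact (integrable_norm_sq_sub _ _).add (integrable_norm_sq_sub _ _)
      · exact (integrable_norm_sq_sub _ _).add (integrable_norm_sq_sub _ _)
    have e4 : D (J r₀) = (rr n 0 - r₀) - (rr m 0 - r₀) := by
      simp [D, rr, hw0]
    have e5 : ‖D (J r₀)‖ ^ 2 ≤ 2 * ‖rr n 0 - r₀‖ ^ 2 + 2 * ‖rr m 0 - r₀‖ ^ 2 := by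
      have := norm_sub_le (rr n 0 - r₀) (rr m 0 - r₀)
      rw [← e4] at this
      nlinarith [norm_nonneg (D (J r₀)), sq_nonneg (‖rr n 0 - r₀‖ - ‖rr m 0 - r₀‖)]
    simp only [b]
    linarith
  have hcau : UniformCauchySeqOn rr atTop (Icc 0 T) := by
    rw [Metric.uniformCauchySeqOn_iff]
    intro ε hε
    obtain ⟨N, hN⟩ := Metric.tendsto_atTop.1 hb0 (ε ^ 2 / 2) (by positivity)
    refine ⟨N, fun m hm n hn t ht => ?_⟩
    have h1 := key m n t ht
    have h2 := hN m hm
    have h3 := hN n hn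
    rw [Real.dist_eq, sub_zero] at h2 h3
    rw [dist_eq_norm]
    refine abs_lt_of_sq_lt_sq' ?_ hε.le |>.2
    linarith [le_abs_self (b m), le_abs_self (b n)]
  have hex : ∀ t, ∃ l, t ∈ Icc 0 T → Tendsto (fun n => rr n t) atTop (𝓝 l) := by
    intro t
    by_cases ht : t ∈ Icc 0 T
    · obtain ⟨l, hl⟩ := cauchySeq_tendsto_of_complete (hcau.cauchySeq ht)
      exact ⟨l, fun _ => hl⟩
    · exact ⟨0, fun h => absurd h ht⟩
  choose r hr using hex
  refine ⟨r, ?_, ?_, fun t ht => ?_, ?_⟩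
  · refine (hcau.tendstoUniformlyOn_of_tendsto hr).continuousOn
      (Frequently.of_forall fun n => ?_)
    exact (J.adjoint ∘L Q n).continuous.comp_continuousOn hwc
  · refine tendsto_nhds_unique (hr 0 ⟨le_rfl, hT⟩) ?_
    simp only [rr, hw0]; exact hlim' r₀
  · exact tendsto_nhds_unique ((J.continuous.tendsto _).comp (hr t ht)) (hlim (w t))
  · filter_upwards [H, ae_restrict_mem measurableSet_Ioc] with t ht htm
    refine tendsto_nhds_unique (hr t (Ioc_subset_Icc_self htm)) ?_
    have : (fun n => rr n t) = fun n => J.adjoint (J (J.adjoint (Q n (y t)))) := by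
      funext n
      simp only [rr, w]
      rw [← ht, hcomm]
    rw [this]
    exact (J.adjoint.continuous.tendsto _).comp (hlim (y t))

end LionsMagenes

/-! ### The nonlinear evolution equation -/

section Nonlinear

variable {V W : Type*} [NormedAddCommGroup V] [InnerProductSpace ℝ V] [CompleteSpace V]
  [NormedAddCommGroup W] [InnerProductSpace ℝ W] [CompleteSpace W]

/-- Solvability of `(J r)' + F(t, z) = 0`, `r = J* z`, for Lipschitz strongly monotone `F`. A solution is a
fixed point of `z ↦ z₀ + R (κ z - F(·, z))`, where `R` solves the linear problem with damping `κ`;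
strong monotonicity makes this a contraction for large `κ`. -/
theorem exists_solution_of_strongMonotone (J : W →L[ℝ] V) (hJ : DenseRange J)
    (hJ' : DenseRange J.adjoint) {T : ℝ} (hT : 0 ≤ T) (F : ℝ → V → V)
    (hmeas : ∀ y : ℝ → V, StronglyMeasurable y → StronglyMeasurable fun t => F t (y t))
    (hF0 : ∀ t, F t 0 = 0) {L α : ℝ} (hL : 0 < L) (hα : 0 < α)
    (hlip : ∀ t v w, ‖F t v - F t w‖ ≤ L * ‖v - w‖)
    (hmono : ∀ t v w, α * ‖v - w‖ ^ 2 ≤ inner ℝ (F t v - F t w) (v - w)) (r₀ : W) :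
    ∃ (z h : L2t V T) (r : ℝ → W),
      (∀ᵐ t ∂volume.restrict (Ioc 0 T), h t = -F t (z t)) ∧
      ContinuousOn r (Icc 0 T) ∧ r 0 = r₀ ∧
      (∀ t ∈ Icc 0 T, J (r t) = J r₀ + ∫ s in (0 : ℝ)..t, h s) ∧
      ∀ᵐ t ∂volume.restrict (Ioc 0 T), r t = J.adjoint (z t) := by
  have hN : ∀ z : L2t V T, ∃ n : L2t V T,
      ∀ᵐ t ∂volume.restrict (Ioc 0 T), n t = F t (z t) := by
    intro z
    have h1 : MemLp (fun t => F t (z t)) 2 (volume.restrict (Ioc 0 T)) := by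
      refine (Lp.memLp z).of_le_mul (c := L) ?_ (Eventually.of_forall fun t => ?_)
      · exact (hmeas z (Lp.stronglyMeasurable z)).aestronglyMeasurable
      · simpa [hF0] using hlip t (z t) 0
    exact ⟨h1.toLp, h1.coeFn_toLp⟩
  choose N hN using hN
  -- `‖κ δ - (F z - F z')‖² ≤ (κ² - 2 κ α + L²) ‖δ‖²` for `δ = z - z'`, and this choice of `κ` gives
  -- `κ² - 2 κ α + L² ≤ κ² - L²`; the summand `L` in `κ` ensures `L < κ`
  set κ : ℝ := L ^ 2 / α + L with hκ_def
  have hκ : 0 < κ := by positivity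
  have hκL : L < κ := by have : 0 < L ^ 2 / α := by positivity
                         linarith
  have hκα : L ^ 2 + L * α = κ * α := by rw [hκ_def]; field_simp
  set c : ℝ := √(κ ^ 2 - L ^ 2) with hc_def
  have hc2 : c ^ 2 = κ ^ 2 - L ^ 2 := Real.sq_sqrt (by nlinarith)
  have hc0 : 0 ≤ c := Real.sqrt_nonneg _
  have hcκ : c < κ := abs_lt_of_sq_lt_sq' (by nlinarith) hκ.le |>.2
  obtain ⟨R, hR, hRlip⟩ := exists_evolOp_section J hT hκ
  obtain ⟨z₀, hz₀⟩ := exists_evolOp_eq_const J hT hκ r₀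
  let S : L2t V T → L2t V T := fun z => κ • z - N z
  have hS : LipschitzWith c.toNNReal S := by
    refine LipschitzWith.of_dist_le_mul fun z z' => ?_
    rw [dist_eq_norm, dist_eq_norm, Real.coe_toNNReal _ hc0]
    refine Lp.norm_le_mul_norm_of_ae_le_mul ?_
    filter_upwards [hN z, hN z', Lp.coeFn_sub (S z) (S z'), Lp.coeFn_sub z z',
      Lp.coeFn_sub (κ • z) (N z), Lp.coeFn_sub (κ • z') (N z'), Lp.coeFn_smul κ z,
      Lp.coeFn_smul κ z'] with t e1 e2 e3 e4 e5 e6 e7 e8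
    have e9 : (S z - S z') t = κ • (z t - z' t) - (F t (z t) - F t (z' t)) := by
      rw [e3, Pi.sub_apply]
      simp only [S]
      rw [e5, e6, Pi.sub_apply, Pi.sub_apply, e7, e8, e1, e2, smul_sub]
      simp only [Pi.smul_apply]
      abel
    rw [e9, e4, Pi.sub_apply]
    refine abs_le_of_sq_le_sq' ?_ (by positivity) |>.2
    rw [norm_sub_sq_real, norm_smul, real_inner_smul_left, real_inner_comm, mul_pow, mul_pow,
      hc2, Real.norm_eq_abs, sq_abs]
    have m1 := mul_le_mul_of_nonneg_left (hmono t (z t) (z' t)) hκ.le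
    have m2 := pow_le_pow_left₀ (norm_nonneg _) (hlip t (z t) (z' t)) 2
    rw [mul_pow] at m2
    rw [← mul_assoc, mul_comm κ α, mul_comm α κ, ← hκα] at m1
    nlinarith [mul_nonneg (mul_nonneg hL.le hα.le) (sq_nonneg ‖z t - z' t‖)]
  have hΦ : LipschitzWith (Real.toNNReal κ⁻¹ * c.toNNReal) fun z => z₀ + R (S z) :=
    LipschitzWith.of_dist_le_mul fun z z' => by
      rw [dist_add_left]
      exact (hRlip.comp hS).dist_le_mul z z'
  have hcon : ContractingWith (Real.toNNReal κ⁻¹ * c.toNNReal) fun z => z₀ + R (S z) := by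
    refine ⟨?_, hΦ⟩
    rw [← NNReal.coe_lt_coe, NNReal.coe_mul, Real.coe_toNNReal _ (by positivity),
      Real.coe_toNNReal _ hc0, NNReal.coe_one, inv_mul_lt_one₀ hκ]
    exact hcκ
  set z := hcon.fixedPoint with hz_def
  have hz : z = z₀ + R (S z) := hcon.fixedPoint_isFixedPt.symm
  have hz1 : evolOp J hT κ z = evolOp J hT κ z₀ + volterra V hT (κ • z - N z) := by
    conv_lhs => rw [hz, map_add, hR]
  have hz2 : (J ∘L J.adjoint).compLpL 2 _ z = evolOp J hT κ z₀ + volterra V hT (-N z) := by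
    have : evolOp J hT κ z = (J ∘L J.adjoint).compLpL 2 _ z + κ • volterra V hT z := rfl
    rw [this, map_sub, map_smul] at hz1
    rw [map_neg]
    have h3 := eq_sub_of_add_eq hz1
    rw [h3]
    abel
  have hH : ∀ᵐ t ∂volume.restrict (Ioc 0 T),
      J (J.adjoint (z t)) = J r₀ + ∫ s in (0 : ℝ)..t, (-N z : L2t V T) s := by
    filter_upwards [(J ∘L J.adjoint).coeFn_compLpL z (p := 2), hz₀, volterra_apply hT (-N z),
      Lp.coeFn_add (evolOp J hT κ z₀) (volterra V hT (-N z))] with t e1 e2 e3 e4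
    rw [hz2, e4, Pi.add_apply, e2, e3] at e1
    exact e1.symm
  obtain ⟨r, hr1, hr2, hr3, hr4⟩ := exists_continuous_lift J hJ hJ' hT z (-N z) r₀ hH
  refine ⟨z, -N z, r, ?_, hr1, hr2, hr3, hr4⟩
  filter_upwards [hN z, Lp.coeFn_neg (N z)] with t e1 e2
  rw [e2, Pi.neg_apply, e1]

/-- The same for `F` that is strongly monotone only after adding `lam • J J*`, by the substitution
`y = exp (lam * t) • z`. -/
theorem exists_solution_of_quasiMonotone (J : W →L[ℝ] V) (hJ : DenseRange J)
    (hJ' : DenseRange J.adjoint) {T : ℝ} (hT : 0 ≤ T) (F : ℝ → V → V)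
    (hmeas : ∀ y : ℝ → V, StronglyMeasurable y → StronglyMeasurable fun t => F t (y t))
    (hF0 : ∀ t, F t 0 = 0) {L α lam : ℝ} (hL : 0 < L) (hα : 0 < α) (hlam : 0 ≤ lam)
    (hlip : ∀ t v w, ‖F t v - F t w‖ ≤ L * ‖v - w‖)
    (hmono : ∀ t v w, α * ‖v - w‖ ^ 2 - lam * ‖J.adjoint (v - w)‖ ^ 2 ≤
      inner ℝ (F t v - F t w) (v - w)) (r₀ : W) :
    ∃ (y : ℝ → V) (r : ℝ → W),
      ContinuousOn r (Icc 0 T) ∧ r 0 = r₀ ∧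
      (∀ᵐ t ∂volume.restrict (Ioo 0 T), r t = J.adjoint (y t)) ∧
      MemLp y 2 (volume.restrict (Ioo 0 T)) ∧
      AbsolutelyContinuousOnInterval (fun t => J (r t)) 0 T ∧
      (∀ᵐ t ∂volume.restrict (Ioo 0 T), HasDerivAt (fun s => J (r s)) (-F t (y t)) t) ∧
      MemLp (fun t => -F t (y t)) 2 (volume.restrict (Ioo 0 T)) := by
  let F' : ℝ → V → V := fun t v =>
    lam • J (J.adjoint v) + Real.exp (-(lam * t)) • F t (Real.exp (lam * t) • v)
  have hsub : ∀ t v w, F' t v - F' t w = lam • J (J.adjoint (v - w)) + Real.exp (-(lam * t)) •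
      (F t (Real.exp (lam * t) • v) - F t (Real.exp (lam * t) • w)) := fun t v w => by
    simp only [F', map_sub, smul_sub]; abel
  have hexp : ∀ t, Real.exp (-(lam * t)) * Real.exp (lam * t) = 1 := fun t => by
    rw [← Real.exp_add]; simp
  have hc1 : Continuous fun t : ℝ => Real.exp (lam * t) := by fun_prop
  have hc2 : Continuous fun t : ℝ => Real.exp (-(lam * t)) := by fun_prop
  obtain ⟨z, h, r, h1, h2, h3, h4, h5⟩ := exists_solution_of_strongMonotone J hJ hJ' hT F'
    (fun y hy => by
      refine StronglyMeasurable.add ?_ ?_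
      · exact ((J ∘L J.adjoint).continuous.comp_stronglyMeasurable hy).const_smul lam
      · exact hc2.stronglyMeasurable.smul (hmeas _ (hc1.stronglyMeasurable.smul hy)))
    (fun t => by simp [F', hF0]) (L := lam * ‖J ∘L J.adjoint‖ + L) (α := α) (by positivity) hα
    (fun t v w => by
      rw [hsub]
      refine (norm_add_le _ _).trans ?_
      rw [norm_smul, norm_smul, Real.norm_of_nonneg hlam, Real.norm_of_nonneg (Real.exp_pos _).le]
      have a1 := (J ∘L J.adjoint).le_opNorm (v - w)
      rw [ContinuousLinearMap.comp_apply] at a1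
      have a2 := hlip t (Real.exp (lam * t) • v) (Real.exp (lam * t) • w)
      rw [← smul_sub, norm_smul, Real.norm_of_nonneg (Real.exp_pos _).le] at a2
      have a3 := mul_le_mul_of_nonneg_left a2 (Real.exp_pos (-(lam * t))).le
      have a4 : Real.exp (-(lam * t)) * (L * (Real.exp (lam * t) * ‖v - w‖)) = L * ‖v - w‖ := by
        linear_combination (L * ‖v - w‖) * hexp t
      have a5 := mul_le_mul_of_nonneg_left a1 hlam
      nlinarith)
    (fun t v w => by
      rw [hsub, inner_add_left, real_inner_smul_left, inner_gram_self, real_inner_smul_left]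
      have a1 := hmono t (Real.exp (lam * t) • v) (Real.exp (lam * t) • w)
      rw [← smul_sub, norm_smul, map_smul, norm_smul, Real.norm_of_nonneg (Real.exp_pos _).le,
        real_inner_smul_right] at a1
      have a2 := mul_le_mul_of_nonneg_left a1
        (mul_pos (Real.exp_pos (-(lam * t))) (Real.exp_pos (-(lam * t)))).le
      have a3 : Real.exp (-(lam * t)) * Real.exp (-(lam * t)) *
          (α * (Real.exp (lam * t) * ‖v - w‖) ^ 2 -
            lam * (Real.exp (lam * t) * ‖J.adjoint (v - w)‖) ^ 2) =
          α * ‖v - w‖ ^ 2 - lam * ‖J.adjoint (v - w)‖ ^ 2 := by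
        linear_combination (α * ‖v - w‖ ^ 2 - lam * ‖J.adjoint (v - w)‖ ^ 2) *
          (Real.exp (-(lam * t)) * Real.exp (lam * t) + 1) * hexp t
      rw [a3] at a2
      have a4 : ∀ x : ℝ, Real.exp (-(lam * t)) * Real.exp (-(lam * t)) *
          (Real.exp (lam * t) * x) = Real.exp (-(lam * t)) * x := fun x => by
        linear_combination (Real.exp (-(lam * t)) * x) * hexp t
      rw [a4] at a2
      linarith) r₀
  have hμ : volume.restrict (Ioo (0 : ℝ) T) = volume.restrict (Ioc 0 T) :=
    Measure.restrict_congr_set Ioo_ae_eq_Ioc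
  have hzy : MemLp (fun t => Real.exp (lam * t) • z t) 2 (volume.restrict (Ioc 0 T)) := by
    refine (Lp.memLp z).of_le_mul (c := Real.exp (lam * T))
      (hc1.aestronglyMeasurable.smul (Lp.aestronglyMeasurable z)) ?_
    filter_upwards [ae_restrict_mem measurableSet_Ioc] with t ht
    rw [norm_smul, Real.norm_of_nonneg (Real.exp_pos _).le]
    gcongr
    exact ht.2
  have hi := intervalIntegrable_L2t hT h
  refine ⟨fun t => Real.exp (lam * t) • z t, fun t => Real.exp (lam * t) • r t,
    hc1.continuousOn.smul h2, by simp [h3], ?_, by rwa [hμ], ?_, ?_, ?_⟩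
  · rw [hμ]
    filter_upwards [h5] with t ht
    rw [ht, map_smul]
  · have a1 : AbsolutelyContinuousOnInterval (fun t => J r₀ + ∫ s in (0 : ℝ)..t, h s) 0 T :=
      (LipschitzWith.const (J r₀)).lipschitzOnWith.absolutelyContinuousOnInterval.add
        (absolutelyContinuous_primitive hi (by simp))
    have a2 : AbsolutelyContinuousOnInterval (fun t => Real.exp (lam * t)) 0 T :=
      ContDiffOn.absolutelyContinuousOnInterval (by fun_prop)
    have a3 := a2.smul a1
    refine Tendsto.congr' ?_ a3
    rw [EventuallyEq, eventually_inf_principal]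
    refine Eventually.of_forall fun I hI => Finset.sum_congr rfl fun i hi => ?_
    have hm := hI.1 i hi
    rw [uIcc_of_le hT] at hm
    simp only [Pi.smul_apply', map_smul, h4 _ hm.1, h4 _ hm.2]
  · have a0 : ∀ᵐ t ∂volume.restrict (Ioo 0 T), t ∈ uIcc 0 T → ∀ c ∈ uIcc 0 T,
        HasDerivAt (fun x => ∫ (t : ℝ) in c..x, h t) (h t) t :=
      ae_restrict_of_ae hi.ae_hasDerivAt_integral
    rw [hμ] at a0
    have am : ∀ᵐ t ∂volume.restrict (Ioc 0 T), t ∈ Ioo 0 T := by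
      rw [← hμ]; exact ae_restrict_mem measurableSet_Ioo
    rw [hμ]
    filter_upwards [a0, am, h1, h5] with t b1 b2 b3 b4
    have b5 := (b1 (by rw [uIcc_of_le hT]; exact Ioo_subset_Icc_self b2) 0 (by simp)).const_add
      (J r₀)
    have b6 : HasDerivAt (fun t : ℝ => Real.exp (lam * t)) (Real.exp (lam * t) * lam) t := by
      simpa using ((hasDerivAt_id t).const_mul lam).exp
    have b7 := b6.smul b5
    have b8 : (fun s => J (Real.exp (lam * s) • r s)) =ᶠ[𝓝 t]
        fun s => Real.exp (lam * s) • (J r₀ + ∫ τ in (0 : ℝ)..s, h τ) := by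
      filter_upwards [Ioo_mem_nhds b2.1 b2.2] with s hs
      rw [map_smul, h4 s (Ioo_subset_Icc_self hs)]
    refine (b7.congr_of_eventuallyEq b8).congr_deriv ?_
    rw [b3, ← h4 t (Ioo_subset_Icc_self b2), b4]
    simp only [F', neg_add, smul_add, smul_neg, smul_smul]
    rw [mul_comm (Real.exp (lam * t)) (Real.exp (-(lam * t))), hexp, one_smul]
    abel
  · rw [hμ]
    refine MemLp.neg (hzy.of_le_mul (c := L) ?_ (Eventually.of_forall fun t => ?_))
    · exact (hmeas _ (hc1.stronglyMeasurable.smul (Lp.stronglyMeasurable z))).aestronglyMeasurable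
    · simpa [hF0] using hlip t (Real.exp (lam * t) • z t) 0

end Nonlinear

section GradientPerturbation

variable {ι V W : Type*} [Fintype ι] [NormedAddCommGroup V] [InnerProductSpace ℝ V]
  [CompleteSpace V] [NormedAddCommGroup W] [InnerProductSpace ℝ W] [CompleteSpace W]

/-- The element `J* m + ∑ᵢ Nᵢ* qᵢ` of `W`. For `W = H¹`, `V = L²`, `J` the inclusion and `N` the
gradient, it represents the functional `φ ↦ ∫ m φ dx + ∫ q · ∇φ dx`, so that it is
`(I - Δ)⁻¹ (m - div q)`. -/
def riesz (J : W →L[ℝ] V) (N : ι → W →L[ℝ] V) (m : V) (q : ι → V) : W :=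
  J.adjoint m + ∑ i, (N i).adjoint (q i)

theorem inner_riesz (J : W →L[ℝ] V) (N : ι → W →L[ℝ] V) (m : V) (q : ι → V) (s : W) :
    inner ℝ (riesz J N m q) s = inner ℝ m (J s) + ∑ i, inner ℝ (q i) (N i s) := by
  rw [riesz, inner_add_left, sum_inner, ContinuousLinearMap.adjoint_inner_left]
  simp only [ContinuousLinearMap.adjoint_inner_left]

theorem riesz_sub (J : W →L[ℝ] V) (N : ι → W →L[ℝ] V) (m m' : V) (q q' : ι → V) :
    riesz J N m q - riesz J N m' q' = riesz J N (m - m') fun i => q i - q' i := by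
  simp only [riesz, map_sub, Finset.sum_sub_distrib]
  abel

theorem exists_norm_riesz_le (J : W →L[ℝ] V) (N : ι → W →L[ℝ] V) :
    ∃ C : ℝ, 0 ≤ C ∧ ∀ (m : V) (q : ι → V) (c : ℝ), ‖m‖ ≤ c → (∀ i, ‖q i‖ ≤ c) →
      ‖riesz J N m q‖ ≤ C * c := by
  refine ⟨‖J.adjoint‖ + ∑ i, ‖(N i).adjoint‖, by positivity, fun m q c hm hq => ?_⟩
  rw [add_mul, Finset.sum_mul]
  exact (norm_add_le _ _).trans (add_le_add (J.adjoint.le_opNorm_of_le hm) ((norm_sum_le _ _).trans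
    (Finset.sum_le_sum fun i _ => (N i).adjoint.le_opNorm_of_le (hq i))))

/-- Solvability of `(J r)' + m(t, y) - J (J* m(t, y) + ∑ᵢ Nᵢ* qᵢ(y)) = 0`, `r = J* y`, for a
Lipschitz strongly monotone `m` and Lipschitz `qᵢ`. The last term paired with `v` is
`⟨J* m + ∑ᵢ Nᵢ* qᵢ, J* v⟩`, so Young's inequality absorbs it into the principal part up to a
multiple of `‖J* v‖²`. -/
theorem exists_solution_of_strongMonotone_sub_riesz [SecondCountableTopology V]
    (J : W →L[ℝ] V) (hJ : DenseRange J)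
    (hJ' : DenseRange J.adjoint) (N : ι → W →L[ℝ] V) {T : ℝ} (hT : 0 ≤ T) (m : ℝ → V → V)
    (q : ι → V → V) (hmeas : ∀ v, StronglyMeasurable fun t => m t v) (hm0 : ∀ t, m t 0 = 0)
    (hq0 : ∀ i, q i 0 = 0) {L α : ℝ} (hL : 0 ≤ L) (hα : 0 < α)
    (hmlip : ∀ t v w, ‖m t v - m t w‖ ≤ L * ‖v - w‖)
    (hqlip : ∀ i v w, ‖q i v - q i w‖ ≤ L * ‖v - w‖)
    (hmono : ∀ t v w, α * ‖v - w‖ ^ 2 ≤ inner ℝ (m t v - m t w) (v - w)) (r₀ : W) :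
    ∃ (r : ℝ → W) (y f : ℝ → V),
      ContinuousOn r (Icc 0 T) ∧ r 0 = r₀ ∧
      (∀ᵐ t ∂volume.restrict (Ioo 0 T), ∀ s, inner ℝ (r t) s = inner ℝ (y t) (J s)) ∧
      MemLp y 2 (volume.restrict (Ioo 0 T)) ∧
      AbsolutelyContinuousOnInterval (fun t => J (r t)) 0 T ∧
      (∀ᵐ t ∂volume.restrict (Ioo 0 T), HasDerivAt (fun s => J (r s)) (f t) t) ∧
      MemLp f 2 (volume.restrict (Ioo 0 T)) ∧
      ∀ t, f t = -(m t (y t) - J (riesz J N (m t (y t)) fun i => q i (y t))) := by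
  let R : ℝ → V → W := fun t v => riesz J N (m t v) fun i => q i v
  let F : ℝ → V → V := fun t v => m t v - J (R t v)
  obtain ⟨C, hC, hriesz⟩ := exists_norm_riesz_le J N
  have hR : ∀ t v w, ‖R t v - R t w‖ ≤ C * L * ‖v - w‖ := fun t v w => by
    simp only [R]
    rw [riesz_sub, mul_assoc]
    exact hriesz _ _ _ (hmlip t v w) fun i => hqlip i v w
  have hFsub : ∀ t v w, F t v - F t w = (m t v - m t w) - J (R t v - R t w) :=
    fun t v w => by simp only [F, map_sub]; abel
  have hFlip : ∀ t v w, ‖F t v - F t w‖ ≤ (L + ‖J‖ * (C * L) + 1) * ‖v - w‖ := fun t v w => by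
    rw [hFsub]
    have h1 := J.le_opNorm_of_le (hR t v w)
    linarith [norm_sub_le (m t v - m t w) (J (R t v - R t w)), hmlip t v w, norm_nonneg (v - w)]
  have hFmono : ∀ t v w, α / 2 * ‖v - w‖ ^ 2 -
      (C * L) ^ 2 / (2 * α) * ‖J.adjoint (v - w)‖ ^ 2 ≤ inner ℝ (F t v - F t w) (v - w) := by
    intro t v w
    rw [hFsub, inner_sub_left, ← ContinuousLinearMap.adjoint_inner_right]
    have h1 := hmono t v w
    have h2 := (real_inner_le_norm (R t v - R t w) (J.adjoint (v - w))).trans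
      (mul_le_mul_of_nonneg_right (hR t v w) (norm_nonneg _))
    have h3 : α / 2 * ‖v - w‖ ^ 2 + (C * L) ^ 2 / (2 * α) * ‖J.adjoint (v - w)‖ ^ 2 -
        C * L * ‖v - w‖ * ‖J.adjoint (v - w)‖ =
        (α * ‖v - w‖ - C * L * ‖J.adjoint (v - w)‖) ^ 2 / (2 * α) := by
      field_simp
      ring
    have h4 : 0 ≤ (α * ‖v - w‖ - C * L * ‖J.adjoint (v - w)‖) ^ 2 / (2 * α) := by positivity
    linarith
  have hF0 : ∀ t, F t 0 = 0 := fun t => by simp [F, R, riesz, hm0, hq0]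
  have hFcont : ∀ t, Continuous (F t) := fun t =>
    (LipschitzWith.of_dist_le_mul (K := (L + ‖J‖ * (C * L) + 1).toNNReal) fun v w => by
      rw [dist_eq_norm, dist_eq_norm, Real.coe_toNNReal _ (by positivity)]
      exact hFlip t v w).continuous
  have hFmeas : ∀ y : ℝ → V, StronglyMeasurable y → StronglyMeasurable fun t => F t (y t) := by
    intro y hy
    borelize V
    have h1 := stronglyMeasurable_uncurry_of_continuous_of_stronglyMeasurable
      (u := fun v t => F t v) hFcont fun v =>
        (hmeas v).sub (J.continuous.comp_stronglyMeasurable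
          ((J.adjoint.continuous.comp_stronglyMeasurable (hmeas v)).add stronglyMeasurable_const))
    exact h1.comp_measurable (hy.measurable.prodMk measurable_id)
  obtain ⟨y, r, h1, h2, h3, h4, h5, h6, h7⟩ := exists_solution_of_quasiMonotone J hJ hJ' hT F
    hFmeas hF0 (by positivity) (half_pos hα) (by positivity) hFlip hFmono r₀
  refine ⟨r, y, fun t => -F t (y t), h1, h2, ?_, h4, h5, h6, h7, fun t => rfl⟩
  filter_upwards [h3] with t ht s
  rw [ht, ContinuousLinearMap.adjoint_inner_left]

end GradientPerturbation

/-! ### Test functions, `H¹` and distributions -/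

variable {d : ℕ}

/-- The class in `L²` of a test function. -/
abbrev testL2 (φ : Test d) : L2 d := (memLp_test φ).toLp φ

/-- Stated for `v : L²`, because `ofFun` is junk on functions that are not locally integrable. -/
theorem ofFun_congr {f : Rd d → ℝ} {v : L2 d} (h : f =ᵐ[volume] v) : ofFun f = ofFun v := by
  have hl : ∀ g : Rd d → ℝ, MemLp g 2 volume → LocallyIntegrableOn g
      ((⊤ : TopologicalSpace.Opens (Rd d)) : Set (Rd d)) volume := fun g hg =>
    (hg.locallyIntegrable (by norm_num)).locallyIntegrableOn _
  ext φ
  have h1 : ofFun v φ = ∫ x, (ContinuousLinearMap.mul ℝ ℝ) (φ x) (v x) :=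
    TestFunction.integralAgainstBilinCLM_eq_integral (hl v (Lp.memLp v))
  have h2 : ofFun f φ = ∫ x, (ContinuousLinearMap.mul ℝ ℝ) (φ x) (f x) :=
    TestFunction.integralAgainstBilinCLM_eq_integral (hl f ((memLp_congr_ae h).2 (Lp.memLp v)))
  rw [h1, h2]
  refine integral_congr_ae ?_
  filter_upwards [h] with x hx
  rw [hx]

/-- Test functions are dense in `L²`, in dual form. -/
theorem eq_zero_of_inner_test (v : L2 d) (h : ∀ φ : Test d, inner ℝ (testL2 φ) v = 0) :
    v = 0 := by
  rw [Lp.eq_zero_iff_ae_eq_zero]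
  refine ae_eq_zero_of_integral_contDiff_smul_eq_zero
    ((Lp.memLp v).locallyIntegrable (by norm_num)) fun g hg hgs => ?_
  let φ : Test d := ⟨g, hg, hgs, by simp⟩
  rw [← h φ, L2.inner_def]
  refine integral_congr_ae ?_
  filter_upwards [(memLp_test φ).coeFn_toLp] with x hx
  rw [hx]
  simp [φ, TestFunction.coe_mk, mul_comm]

theorem inner_testL2 (φ ψ : Test d) : inner ℝ (testL2 φ) (testL2 ψ) = ∫ x, φ x * ψ x := by
  rw [L2.inner_def]
  refine integral_congr_ae ?_
  filter_upwards [(memLp_test φ).coeFn_toLp, (memLp_test ψ).coeFn_toLp] with x h1 h2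
  rw [h1, h2]
  simp [mul_comm]

theorem test_lineDeriv_apply (φ : Test d) (v x : Rd d) :
    (∂_{v} φ : Test d) x = fderiv ℝ φ x v := by
  rw [TestFunction.lineDerivOp_eq_lineDerivCLM ℝ, TestFunction.lineDerivCLM_eq_fderivCLM,
    TestFunction.fderivCLM_apply_of_le _ (by simp)]

theorem testL2_neg (φ : Test d) : testL2 (-φ) = -testL2 φ := by
  rw [testL2, testL2, ← MemLp.toLp_neg]
  rfl

/-- Integration by parts for test functions. -/
theorem inner_testL2_lineDeriv (φ ψ : Test d) (v : Rd d) :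
    inner ℝ (testL2 (-∂_{v} φ)) (testL2 ψ) = inner ℝ (testL2 φ) (testL2 (∂_{v} ψ)) := by
  have hint : ∀ f g : Test d, Integrable (fun x => f x * g x) volume := fun f g =>
    (f.continuous.mul g.continuous).integrable_of_hasCompactSupport
      (f.hasCompactSupport.mul_right)
  rw [testL2_neg, inner_neg_left, inner_testL2, inner_testL2]
  have h := integral_mul_fderiv_eq_neg_fderiv_mul_of_integrable (μ := volume) (𝕜 := ℝ)
    (f := φ) (g := ψ) (v := v)
    (by simpa only [test_lineDeriv_apply] using hint (∂_{v} φ) ψ)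
    (by simpa only [test_lineDeriv_apply] using hint φ (∂_{v} ψ))
    (hint φ ψ) (fun x _ => (φ.contDiff.differentiable (by simp)).differentiableAt)
    (fun x _ => (ψ.contDiff.differentiable (by simp)).differentiableAt)
  simp only [test_lineDeriv_apply]
  rw [h]

/-- A test function, with its gradient, as an element of `H¹`. -/
def testH1 (φ : Test d) : H1 d :=
  ⟨WithLp.toLp 2 (testL2 φ, WithLp.toLp 2 fun i => testL2 (∂_{(e i : Rd d)} φ)), fun i => by
    ext ψ
    rw [Distribution.lineDerivOp_apply_apply, ofFun_L2_apply, ofFun_L2_apply]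
    exact inner_testL2_lineDeriv ψ φ (e i)⟩

/-- The `i`-th component of the gradient, `H¹ → L²`. -/
def gradComp (i : Fin d) : H1 d →L[ℝ] L2 d :=
  (PiLp.proj 2 (fun _ : Fin d => L2 d) i).comp
    ((WithLp.sndL 2 ℝ (L2 d) (PiLp 2 (fun _ : Fin d => L2 d))).comp (H1 d).subtypeL)

theorem inner_prod_piLp {ι E : Type*} [Fintype ι] [NormedAddCommGroup E] [InnerProductSpace ℝ E]
    (x y : WithLp 2 (E × PiLp 2 (fun _ : ι => E))) :
    inner ℝ x y = inner ℝ x.fst y.fst + ∑ i, inner ℝ (x.snd i) (y.snd i) := by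
  rw [WithLp.prod_inner_apply, PiLp.inner_apply]
  rfl

theorem H1toL2_apply (s : H1 d) : H1toL2 d s = s.1.fst := rfl

theorem gradComp_apply (i : Fin d) (s : H1 d) : gradComp i s = s.1.snd i := rfl

theorem inner_H1 (s r : H1 d) : inner ℝ s r =
    inner ℝ (H1toL2 d s) (H1toL2 d r) + ∑ i, inner ℝ (gradComp i s) (gradComp i r) := by
  simp only [H1toL2_apply, gradComp_apply]
  exact inner_prod_piLp s.1 r.1

theorem H1toL2_testH1 (φ : Test d) : H1toL2 d (testH1 φ) = testL2 φ := rfl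

theorem gradComp_testH1 (i : Fin d) (φ : Test d) :
    gradComp i (testH1 φ) = testL2 (∂_{(e i : Rd d)} φ) := rfl

theorem lineDeriv_ofFun_H1toL2 (s : H1 d) (i : Fin d) :
    ∂_{(e i : Rd d)} (ofFun (H1toL2 d s)) = ofFun (gradComp i s) := s.2 i

theorem lap_ofFun_L2_apply (v : L2 d) (φ : Test d) : lap (ofFun v) φ =
    ∑ i : Fin d, inner ℝ (testL2 (∂_{(e i : Rd d)} (∂_{(e i : Rd d)} φ))) v := by
  rw [lap]
  have : ∀ (S : Fin d → Distr d), (∑ i, S i) φ = ∑ i, S i φ := fun S => by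
    simp
  rw [this]
  refine Finset.sum_congr rfl fun i _ => ?_
  rw [Distribution.lineDerivOp_apply_apply, Distribution.lineDerivOp_apply_apply, ofFun_L2_apply]
  simp

/-- The properties of `H¹` that the existence proof uses, for an abstract Hilbert space `W`: `J` is the
inclusion into `L²`, `N i` are the components of the gradient, and `τ` embeds the test functions. The
abstract form keeps the instances on the concrete space `H1 d` out of the proofs. -/
structure IsSobolevSpace {W : Type*} [NormedAddCommGroup W] [InnerProductSpace ℝ W]
    (J : W →L[ℝ] L2 d) (N : Fin d → W →L[ℝ] L2 d) (τ : Test d → W) : Prop where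
  inner_eq : ∀ s r : W, inner ℝ s r = inner ℝ (J s) (J r) + ∑ i, inner ℝ (N i s) (N i r)
  incl_test : ∀ φ, J (τ φ) = testL2 φ
  grad_test : ∀ i φ, N i (τ φ) = testL2 (∂_{(e i : Rd d)} φ)
  lineDeriv_ofFun : ∀ s i, ∂_{(e i : Rd d)} (ofFun (J s)) = ofFun (N i s)

theorem isSobolevSpace_H1 (d : ℕ) :
    IsSobolevSpace (d := d) (W := H1 d) (H1toL2 d) (fun i => gradComp i) testH1 :=
  ⟨inner_H1, H1toL2_testH1, gradComp_testH1, lineDeriv_ofFun_H1toL2⟩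

theorem distr_sum_apply (S : Fin d → Distr d) (φ : Test d) : (∑ i, S i) φ = ∑ i, S i φ := by
  simp

theorem VDualToDistr_innerSL_apply (f : L2 d) (φ : Test d) :
    VDualToDistr (innerSL ℝ f) φ = inner ℝ (testL2 φ) f -
      ∑ i : Fin d, inner ℝ (testL2 (∂_{(e i : Rd d)} (∂_{(e i : Rd d)} φ))) f := by
  have h : (InnerProductSpace.toDual ℝ (L2 d)).symm (innerSL ℝ f) = f := by
    rw [LinearIsometryEquiv.symm_apply_eq]
    rfl
  rw [VDualToDistr, h, ← lap_ofFun_L2_apply, ← ofFun_L2_apply]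
  rfl

theorem denseRange_of_orthogonal {E F : Type*} [NormedAddCommGroup E] [InnerProductSpace ℝ E]
    [NormedAddCommGroup F] [InnerProductSpace ℝ F] [CompleteSpace F] (A : E →L[ℝ] F)
    (h : ∀ v, (∀ x, inner ℝ (A x) v = 0) → v = 0) : DenseRange A := by
  have h1 : (LinearMap.range (A : E →ₗ[ℝ] F)).topologicalClosure = ⊤ := by
    rw [Submodule.topologicalClosure_eq_top_iff, Submodule.eq_bot_iff]
    intro v hv
    exact h v fun x => (Submodule.mem_orthogonal _ v).1 hv _ ⟨x, rfl⟩
  exact Submodule.dense_iff_topologicalClosure_eq_top.2 h1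

namespace IsSobolevSpace

variable {W : Type*} [NormedAddCommGroup W] [InnerProductSpace ℝ W]
  {J : W →L[ℝ] L2 d} {N : Fin d → W →L[ℝ] L2 d} {τ : Test d → W}

/-- The distribution `(I - Δ) s`, for `s ∈ H¹`, is the functional `φ ↦ ⟨s, φ⟩` given by the inner
product of `H¹`. -/
theorem idSubLap_apply (h : IsSobolevSpace J N τ) (s : W) (φ : Test d) :
    inner ℝ (testL2 φ) (J s) -
      ∑ i : Fin d, inner ℝ (testL2 (∂_{(e i : Rd d)} (∂_{(e i : Rd d)} φ))) (J s) =
      inner ℝ s (τ φ) := by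
  rw [h.inner_eq, h.incl_test, sub_eq_add_neg, ← Finset.sum_neg_distrib,
    real_inner_comm (J s) (testL2 φ)]
  congr 1
  refine Finset.sum_congr rfl fun i _ => ?_
  have h1 := congrArg (fun S : Distr d => S (∂_{(e i : Rd d)} φ)) (h.lineDeriv_ofFun s i)
  simp only [Distribution.lineDerivOp_apply_apply, ofFun_L2_apply] at h1
  rw [h.grad_test, real_inner_comm (testL2 (∂_{(e i : Rd d)} φ)) (N i s)]
  refine Eq.trans ?_ h1
  rw [← inner_neg_left, ← testL2_neg]

/-- The identification of `(L²)*` with `(I - Δ) L²` turns `m - J (I - Δ)⁻¹ (m - div q)` into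
`-Δ m + div q`. -/
theorem VDualToDistr_add_lap_dvg [CompleteSpace W] (h : IsSobolevSpace J N τ) (m : L2 d) (q : Fin d → L2 d) :
    VDualToDistr (innerSL ℝ (-(m - J (riesz J N m q)))) +
      (-lap (ofFun m) + dvg fun i => ofFun (q i)) = 0 := by
  ext φ
  have h1 := h.idSubLap_apply (riesz J N m q) φ
  have h3 : inner ℝ (riesz J N m q) (τ φ) =
      inner ℝ m (testL2 φ) + ∑ i, inner ℝ (q i) (testL2 (∂_{(e i : Rd d)} φ)) := by
    rw [inner_riesz, h.incl_test]
    simp only [h.grad_test]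
  have h2 : (dvg fun i => ofFun (q i)) φ =
      -∑ i, inner ℝ (q i) (testL2 (∂_{(e i : Rd d)} φ)) := by
    rw [dvg, distr_sum_apply, ← Finset.sum_neg_distrib]
    refine Finset.sum_congr rfl fun i _ => ?_
    rw [Distribution.lineDerivOp_apply_apply, ofFun_L2_apply,
      real_inner_comm (testL2 (∂_{(e i : Rd d)} φ)) (q i), ← inner_neg_left, ← testL2_neg]
  change VDualToDistr _ φ + (-(lap (ofFun m) φ) + (dvg fun i => ofFun (q i)) φ) = 0
  rw [VDualToDistr_innerSL_apply, lap_ofFun_L2_apply, h2]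
  rw [h3, real_inner_comm (testL2 φ) m] at h1
  simp only [neg_sub, inner_sub_right, Finset.sum_sub_distrib]
  linarith

theorem denseRange_incl (h : IsSobolevSpace J N τ) : DenseRange J :=
  denseRange_of_orthogonal _ fun v hv => eq_zero_of_inner_test v fun φ => by
    rw [← h.incl_test]
    exact hv (τ φ)

theorem denseRange_adjoint [CompleteSpace W] (h : IsSobolevSpace J N τ) : DenseRange J.adjoint := by
  refine denseRange_of_orthogonal _ fun s hs => ?_
  have h1 : J s = 0 := ext_inner_left ℝ fun x => by
    rw [← ContinuousLinearMap.adjoint_inner_left, hs, inner_zero_right]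
  have h2 : ∀ i, N i s = 0 := fun i => eq_zero_of_inner_test _ fun φ => by
    have h3 := congrArg (fun S : Distr d => S φ) (h.lineDeriv_ofFun s i)
    simp only [Distribution.lineDerivOp_apply_apply, ofFun_L2_apply] at h3
    rw [testL2, ← h3, h1, inner_zero_right]
  rw [← inner_self_eq_zero (𝕜 := ℝ), h.inner_eq, h1]
  simp [h2]

end IsSobolevSpace

/-! ### Measurability in time and superposition operators -/

/-- Pettis' theorem in a separable Hilbert space: a weakly measurable function is the limit of its
projections on the spans of finitely many members of a dense sequence. -/
theorem stronglyMeasurable_of_inner {Ω H : Type*} [MeasurableSpace Ω] [NormedAddCommGroup H]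
    [InnerProductSpace ℝ H] [CompleteSpace H] [SecondCountableTopology H] {f : Ω → H}
    (h : ∀ w, StronglyMeasurable fun t => (inner ℝ w (f t) : ℝ)) : StronglyMeasurable f := by
  obtain ⟨s, hs⟩ := TopologicalSpace.exists_dense_seq H
  let U : ℕ → Submodule ℝ H := fun n => Submodule.span ℝ (s '' Iio n)
  have hfin : ∀ n, FiniteDimensional ℝ (U n) := fun n =>
    FiniteDimensional.span_of_finite ℝ ((finite_Iio n).image s)
  have hU : Monotone U := fun m n hmn =>
    Submodule.span_mono (image_mono (Iio_subset_Iio hmn))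
  have hU' : ⊤ ≤ (⨆ n, U n).topologicalClosure := by
    rw [top_le_iff, ← Submodule.dense_iff_topologicalClosure_eq_top]
    refine hs.mono ?_
    rintro _ ⟨n, rfl⟩
    exact Submodule.mem_iSup_of_mem (n + 1)
      (Submodule.subset_span ⟨n, Nat.lt_succ_self n, rfl⟩)
  refine stronglyMeasurable_of_tendsto (f := fun n t => (U n).starProjection (f t)) atTop
    (fun n => ?_) (tendsto_pi_nhds.2 fun t => Submodule.starProjection_tendsto_self U hU (f t) hU')
  have e1 : ∀ x, (U n).starProjection x = ∑ i, (inner ℝ (stdOrthonormalBasis ℝ (U n) i : H) x : ℝ) •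
      (stdOrthonormalBasis ℝ (U n) i : H) := fun x => by
    rw [(stdOrthonormalBasis ℝ (U n)).starProjection_eq_sum_rankOne]
    simp
  simp only [e1]
  refine Finset.stronglyMeasurable_fun_sum _ fun i _ => ?_
  exact (h _).smul_const _

instance : SecondCountableTopology (L2 d) :=
  have : Fact ((2 : ℝ≥0∞) ≠ ∞) := ⟨by norm_num⟩
  inferInstance

theorem exists_mulL2 {c : Rd d → ℝ} (hc : MemLp c ∞ volume) :
    ∃ M : L2 d →L[ℝ] L2 d, ∀ v : L2 d, M v =ᵐ[volume] fun x => c x * v x := by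
  refine ⟨(ContinuousLinearMap.mul ℝ ℝ).holderL volume ∞ 2 2 hc.toLp, fun v => ?_⟩
  filter_upwards [(ContinuousLinearMap.mul ℝ ℝ).coeFn_holder (r := 2) hc.toLp v, hc.coeFn_toLp]
    with x h1 h2
  rw [ContinuousLinearMap.holderL_apply_apply, h1, h2]
  rfl

theorem stronglyMeasurable_mulL2 {u : ℝ × Rd d → ℝ} (hu : StronglyMeasurable u)
    {M : ℝ → L2 d →L[ℝ] L2 d} (hM : ∀ t v, M t v =ᵐ[volume] fun x => u (t, x) * v x) (v : L2 d) :
    StronglyMeasurable fun t => M t v := by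
  refine stronglyMeasurable_of_inner fun w => ?_
  have h1 : ∀ t, (inner ℝ w (M t v) : ℝ) = ∫ x, u (t, x) * v x * w x := fun t => by
    rw [L2.inner_def]
    refine integral_congr_ae ?_
    filter_upwards [hM t v] with x hx
    rw [hx]
    simp
  simp only [h1]
  refine StronglyMeasurable.integral_prod_right (f := fun t x => u (t, x) * v x * w x) ?_
  exact (hu.mul ((Lp.stronglyMeasurable v).comp_measurable measurable_snd)).mul
    ((Lp.stronglyMeasurable w).comp_measurable measurable_snd)

/-- An admissible control, modified on a null set so as to be jointly measurable and to satisfy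
the bounds everywhere, acts on `L²` by multiplication. -/
theorem IsAdmissible.exists_mul {T γ₁ γ₂ γ₃ : ℝ} {u : ℝ → Rd d → ℝ}
    (hu : IsAdmissible T γ₁ γ₂ γ₃ u) :
    ∃ (M : ℝ → L2 d →L[ℝ] L2 d) (C : ℝ), 0 ≤ C ∧ (∀ v, StronglyMeasurable fun t => M t v) ∧
      (∀ t v, ‖M t v‖ ≤ C * ‖v‖) ∧
      (∀ t (v w : L2 d), (∀ᵐ x, 0 ≤ v x * w x) →
        γ₁ * ∫ x, v x * w x ≤ inner ℝ (M t v) w) ∧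
      ∀ᵐ t ∂volume.restrict (Ioo 0 T), ∀ v : L2 d, (fun x => u t x * v x) =ᵐ[volume] M t v := by
  -- truncating at `γ₁` from outside keeps the lower bound everywhere, whatever the order of `γ₁, γ₂`
  let u₀ : ℝ × Rd d → ℝ := fun p => max γ₁ (min γ₂ (hu.measurable.mk _ p))
  have hm : StronglyMeasurable u₀ :=
    stronglyMeasurable_const.sup (stronglyMeasurable_const.inf hu.measurable.stronglyMeasurable_mk)
  have hb1 : ∀ p, γ₁ ≤ u₀ p := fun p => le_max_left _ _
  have hb2 : ∀ p, |u₀ p| ≤ |γ₁| + |γ₂| := fun p => by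
    have h1 : u₀ p ≤ max γ₁ γ₂ := max_le_max le_rfl (min_le_left _ _)
    rw [abs_le]
    constructor
    · linarith [hb1 p, neg_abs_le γ₁, abs_nonneg γ₂]
    · refine h1.trans (max_le ?_ ?_)
      · linarith [le_abs_self γ₁, abs_nonneg γ₂]
      · linarith [le_abs_self γ₂, abs_nonneg γ₁]
  have hmt : ∀ t, StronglyMeasurable fun x => u₀ (t, x) := fun t =>
    hm.comp_measurable measurable_prodMk_left
  choose M hM using fun t => exists_mulL2 (c := fun x => u₀ (t, x)) (memLp_top_of_bound
    (hmt t).aestronglyMeasurable (|γ₁| + |γ₂|) (Eventually.of_forall fun x => hb2 (t, x)))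
  refine ⟨M, |γ₁| + |γ₂|, by positivity, stronglyMeasurable_mulL2 hm hM, fun t v => ?_,
    fun t v w hvw => ?_, ?_⟩
  · refine Lp.norm_le_mul_norm_of_ae_le_mul ?_
    filter_upwards [hM t v] with x hx
    rw [hx, norm_mul]
    exact mul_le_mul_of_nonneg_right (hb2 (t, x)) (norm_nonneg _)
  · rw [L2.inner_def, ← integral_const_mul]
    refine integral_mono_ae ?_ (L2.integrable_inner _ _) ?_
    · refine Integrable.const_mul ?_ γ₁
      refine (L2.integrable_inner (𝕜 := ℝ) v w).congr (Eventually.of_forall fun x => ?_)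
      simp [mul_comm]
    · filter_upwards [hM t v, hvw] with x hx h0
      rw [hx]
      have := mul_le_mul_of_nonneg_right (hb1 (t, x)) h0
      simp only [RCLike.inner_apply, conj_trivial]
      linarith
  · have h1 : ∀ᵐ p : ℝ × Rd d ∂((volume.restrict (Ioo 0 T)).prod volume), u p.1 p.2 = u₀ p := by
      filter_upwards [hu.measurable.ae_eq_mk, hu.bounds] with p h1 h2
      simp only [u₀]
      rw [← h1, min_eq_right h2.2, max_eq_right h2.1]
    filter_upwards [Measure.ae_ae_of_ae_prod h1] with t ht v
    filter_upwards [ht, hM t v] with x h2 h3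
    rw [h3, h2]

/-- The superposition operators `v ↦ β(v)` and `v ↦ Dᵢ b(v) v` are Lipschitz on `L²`: `r ↦ b(r) r` is
Lipschitz because it is dominated by the Lipschitz function `β`. -/
theorem CoefficientAssumption.exists_nemytskii {β b : ℝ → ℝ} {D : Rd d → Rd d}
    (h : CoefficientAssumption β b D) :
    ∃ (B : L2 d → L2 d) (q : Fin d → L2 d → L2 d) (L α : ℝ), 0 ≤ L ∧ 0 < α ∧
      (∀ v, (B v : Rd d → ℝ) =ᵐ[volume] fun x => β (v x)) ∧
      (∀ i v, (fun x => D x i * (b (v x) * v x)) =ᵐ[volume] q i v) ∧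
      B 0 = 0 ∧ (∀ i, q i 0 = 0) ∧
      (∀ v w, ‖B v - B w‖ ≤ L * ‖v - w‖) ∧ (∀ i v w, ‖q i v - q i w‖ ≤ L * ‖v - w‖) ∧
      ∀ a c : ℝ, α * (a - c) ^ 2 ≤ (β a - β c) * (a - c) := by
  obtain ⟨L₁, hL₁⟩ := h.lipschitz_beta
  obtain ⟨α, hα, hα'⟩ := h.deriv_beta
  obtain ⟨α₂, hα₂, hcomp⟩ := h.compare
  have hh : LipschitzWith (α₂.toNNReal * L₁) fun a => b a * a := by
    refine LipschitzWith.of_dist_le_mul fun a c => ?_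
    rw [Real.dist_eq, NNReal.coe_mul, Real.coe_toNNReal _ hα₂, mul_assoc]
    exact (hcomp a c).trans (mul_le_mul_of_nonneg_left (hL₁.dist_le_mul a c) hα₂)
  have hD : ∀ i, MemLp (fun x => D x i) ∞ volume := fun i => by
    refine h.memLp_D.of_le ?_ (Eventually.of_forall fun x => PiLp.norm_apply_le (D x) i)
    exact (by fun_prop : Continuous fun z : Rd d => z i).comp_aestronglyMeasurable
      h.memLp_D.aestronglyMeasurable
  choose M hM using fun i => exists_mulL2 (hD i)
  have hBl := LipschitzWith.lipschitzWith_compLp (p := 2) (μ := (volume : Measure (Rd d))) hL₁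
    h.beta_zero
  have hql := LipschitzWith.lipschitzWith_compLp (p := 2) (μ := (volume : Measure (Rd d))) hh
    (mul_zero _)
  refine ⟨hL₁.compLp h.beta_zero, fun i v => M i (hh.compLp (mul_zero _) v),
    L₁ + (∑ i, ‖M i‖) * (α₂ * L₁), α, by positivity, hα, fun v => hL₁.coeFn_compLp _ v,
    fun i v => ?_, LipschitzWith.compLp_zero _ _, fun i => by
      simp only [LipschitzWith.compLp_zero, map_zero], fun v w => ?_, fun i v w => ?_, fun a c => ?_⟩
  · filter_upwards [hM i (hh.compLp (mul_zero _) v), hh.coeFn_compLp (mul_zero _) v] with x h1 h2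
    rw [h1, h2]
    rfl
  · have h1 := hBl.dist_le_mul v w
    rw [dist_eq_norm, dist_eq_norm] at h1
    refine h1.trans (mul_le_mul_of_nonneg_right ?_ (norm_nonneg _))
    have : 0 ≤ (∑ i, ‖M i‖) * (α₂ * L₁) := by positivity
    linarith
  · have h1 := hql.dist_le_mul v w
    rw [dist_eq_norm, dist_eq_norm, NNReal.coe_mul, Real.coe_toNNReal _ hα₂] at h1
    rw [← map_sub]
    refine ((M i).le_opNorm _).trans ?_
    have h2 : ‖M i‖ ≤ ∑ i, ‖M i‖ :=
      Finset.single_le_sum (f := fun i => ‖M i‖) (fun j _ => norm_nonneg _) (Finset.mem_univ i)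
    calc _ ≤ (∑ i, ‖M i‖) * (α₂ * L₁ * ‖v - w‖) :=
          mul_le_mul h2 h1 (norm_nonneg _) (by positivity)
      _ = (∑ i, ‖M i‖) * (α₂ * L₁) * ‖v - w‖ := by ring
      _ ≤ _ := mul_le_mul_of_nonneg_right (by linarith [L₁.coe_nonneg]) (norm_nonneg _)
  · have hd := h.contDiff_beta.differentiable (by simp)
    rcases le_total a c with hac | hac
    · have := mul_sub_le_image_sub_of_le_deriv hd hα' hac
      nlinarith
    · have := mul_sub_le_image_sub_of_le_deriv hd hα' hac
      nlinarith

/-! ### The Fokker–Planck equation -/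

/-- Integrated form of the strong monotonicity of `β`. -/
theorem mul_norm_sq_le_inner {γ α : ℝ} (hγ : 0 ≤ γ) (hα : 0 ≤ α) {M : L2 d →L[ℝ] L2 d}
    (hM : ∀ v w : L2 d, (∀ᵐ x, 0 ≤ v x * w x) → γ * ∫ x, v x * w x ≤ inner ℝ (M v) w)
    (f v : L2 d) (h : ∀ᵐ x, α * (v x * v x) ≤ f x * v x) :
    γ * α * ‖v‖ ^ 2 ≤ inner ℝ (M f) v := by
  refine le_trans ?_ (hM f v (h.mono fun x hx => le_trans (mul_nonneg hα (mul_self_nonneg _)) hx))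
  rw [mul_assoc]
  refine mul_le_mul_of_nonneg_left ?_ hγ
  have h2 : Integrable (fun x => f x * v x) volume :=
    (L2.integrable_inner (𝕜 := ℝ) f v).congr (Eventually.of_forall fun x => by simp [mul_comm])
  rw [← real_inner_self_eq_norm_sq, L2.inner_def, ← integral_const_mul]
  refine integral_mono_ae ((L2.integrable_inner _ _).const_mul α) h2 ?_
  filter_upwards [h] with x hx
  rw [← pow_two] at hx
  simpa using hx

theorem fpOperator_eq {β b : ℝ → ℝ} {D : Rd d → Rd d} {u : Rd d → ℝ} {y m : L2 d}
    {q : Fin d → L2 d} (hm : (fun x => u x * β (y x)) =ᵐ[volume] m)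
    (hq : ∀ i, (fun x => D x i * (b (y x) * y x)) =ᵐ[volume] q i) :
    fpOperator β b D u y = -lap (ofFun m) + dvg fun i => ofFun (q i) := by
  have h : (fun i => ofFun fun x => D x i * (b (y x) * y x)) = fun i => ofFun (q i) :=
    funext fun i => ofFun_congr (hq i)
  rw [fpOperator, ofFun_congr hm, h]

/-- Existence for the Fokker–Planck equation, with `H¹` replaced by `W` and `H⁻¹` by `W` through the Riesz
isomorphism: `r(t)` is `(I - Δ)⁻¹ ρ(t)`, and `f` is the derivative of `J r` in `L² ≅ (L²)*`. -/
theorem IsSobolevSpace.exists_solution {W : Type*} [NormedAddCommGroup W] [InnerProductSpace ℝ W]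
    [CompleteSpace W] {J : W →L[ℝ] L2 d} {N : Fin d → W →L[ℝ] L2 d} {τ : Test d → W}
    (hW : IsSobolevSpace J N τ) {T γ₁ γ₂ γ₃ : ℝ} (hT : 0 ≤ T) (hγ₁ : 0 < γ₁)
    {β b : ℝ → ℝ} {D : Rd d → Rd d} (hcoef : CoefficientAssumption β b D)
    {u : ℝ → Rd d → ℝ} (hu : IsAdmissible T γ₁ γ₂ γ₃ u) (r₀ : W) :
    ∃ (r : ℝ → W) (y f : ℝ → L2 d),
      ContinuousOn r (Icc 0 T) ∧ r 0 = r₀ ∧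
      (∀ᵐ t ∂volume.restrict (Ioo 0 T), ∀ s, inner ℝ (r t) s = inner ℝ (y t) (J s)) ∧
      MemLp y 2 (volume.restrict (Ioo 0 T)) ∧
      AbsolutelyContinuousOnInterval (fun t => J (r t)) 0 T ∧
      (∀ᵐ t ∂volume.restrict (Ioo 0 T), HasDerivAt (fun s => J (r s)) (f t) t) ∧
      MemLp f 2 (volume.restrict (Ioo 0 T)) ∧
      ∀ᵐ t ∂volume.restrict (Ioo 0 T),
        VDualToDistr (innerSL ℝ (f t)) + fpOperator β b D (u t) (y t) = 0 := by
  obtain ⟨M, C, hC, hMmeas, hMle, hMpos, hMu⟩ := hu.exists_mul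
  obtain ⟨B, q, L, α, hL, hα, hB, hq, hB0, hq0, hBlip, hqlip, hmono⟩ := hcoef.exists_nemytskii
  have hpos : ∀ t v w, γ₁ * α * ‖v - w‖ ^ 2 ≤ inner ℝ (M t (B v) - M t (B w)) (v - w) := by
    intro t v w
    have h0 : ∀ᵐ x, α * ((v - w) x * (v - w) x) ≤ (B v - B w) x * (v - w) x := by
      filter_upwards [hB v, hB w, Lp.coeFn_sub v w, Lp.coeFn_sub (B v) (B w)] with x h1 h2 h3 h4
      rw [h3, h4, Pi.sub_apply, Pi.sub_apply, h1, h2]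
      linarith [hmono (v x) (w x)]
    rw [← map_sub]
    exact mul_norm_sq_le_inner hγ₁.le hα.le (hMpos t) _ _ h0
  obtain ⟨r, y, f, h1, h2, h3, h4, h5, h6, h7, h8⟩ :=
    exists_solution_of_strongMonotone_sub_riesz J hW.denseRange_incl hW.denseRange_adjoint N hT
      (fun t v => M t (B v)) q (fun v => hMmeas (B v)) (fun t => by simp only [hB0, map_zero]) hq0
      (L := (C + 1) * L) (by positivity) (mul_pos hγ₁ hα)
      (fun t v w => by
        rw [← map_sub, mul_assoc]
        have a1 := (hMle t (B v - B w)).trans (mul_le_mul_of_nonneg_left (hBlip v w) hC)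
        linarith [mul_nonneg hL (norm_nonneg (v - w))])
      (fun i v w => by
        have a1 := mul_nonneg hC (mul_nonneg hL (norm_nonneg (v - w)))
        linarith [hqlip i v w]) hpos r₀
  refine ⟨r, y, f, h1, h2, h3, h4, h5, h6, h7, ?_⟩
  filter_upwards [hMu] with t ht
  have e1 : (fun x => u t x * β (y t x)) =ᵐ[volume] M t (B (y t)) := by
    filter_upwards [ht (B (y t)), hB (y t)] with x g1 g2
    rw [← g1, g2]
  rw [h8, fpOperator_eq e1 fun i => hq i (y t)]
  exact hW.VDualToDistr_add_lap_dvg _ _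

end FokkerPlanck

end

theorem mainTheorem4 {d : ℕ} (T γ₁ γ₂ γ₃ : ℝ) (hT : 0 < T) (hγ₁ : 0 < γ₁)
    (β b : ℝ → ℝ) (D : FokkerPlanck.Rd d → FokkerPlanck.Rd d)
    (hcoef : FokkerPlanck.CoefficientAssumption β b D)
    (u : ℝ → FokkerPlanck.Rd d → ℝ) (hu : FokkerPlanck.IsAdmissible T γ₁ γ₂ γ₃ u)
    (ρ₀ : FokkerPlanck.Hm1 d) :
    ∃ (ρ : ℝ → FokkerPlanck.Hm1 d) (y : ℝ → FokkerPlanck.L2 d) (ρ' : ℝ → FokkerPlanck.VDual d),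
      -- `ρ ∈ C([0,T]; H⁻¹)`
      ContinuousOn ρ (Icc 0 T) ∧
      -- `ρ ∈ L²(0,T; L²)`: `y` is `ρ` seen as an `L²`-valued function
      (∀ᵐ t ∂(volume.restrict (Ioo 0 T)), ρ t = FokkerPlanck.L2toHm1 (y t)) ∧
      MemLp y 2 (volume.restrict (Ioo 0 T)) ∧
      -- `ρ : [0,T] → (L²)*` is absolutely continuous with `dρ/dt = ρ' ∈ L²(0,T; (L²)*)`
      AbsolutelyContinuousOnInterval (fun t => FokkerPlanck.Hm1toVDual (ρ t)) 0 T ∧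
      (∀ᵐ t ∂(volume.restrict (Ioo 0 T)), HasDerivAt (fun s => FokkerPlanck.Hm1toVDual (ρ s)) (ρ' t) t) ∧
      MemLp ρ' 2 (volume.restrict (Ioo 0 T)) ∧
      -- `dρ/dt(t) + A(t) ρ(t) = 0` for a.e. `t`, and `ρ(0) = ρ₀`
      (∀ᵐ t ∂(volume.restrict (Ioo 0 T)),
        FokkerPlanck.VDualToDistr (ρ' t) + FokkerPlanck.fpOperator β b D (u t) (y t) = 0) ∧
      ρ 0 = ρ₀ := by
  obtain ⟨r, y, f, h1, h2, h3, h4, h5, h6, h7, h8⟩ :=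
    (FokkerPlanck.isSobolevSpace_H1 d).exists_solution hT.le hγ₁ hcoef hu
      (FokkerPlanck.invIdSubLap ρ₀)
  let E := InnerProductSpace.toDual ℝ (FokkerPlanck.H1 d)
  have hE : ∀ s, FokkerPlanck.Hm1toVDual (E s) = innerSL ℝ (FokkerPlanck.H1toL2 d s) := fun s =>
    congrArg (fun z => (innerSL ℝ (FokkerPlanck.H1toL2 d z) : FokkerPlanck.VDual d))
      (E.symm_apply_apply s)
  refine ⟨fun t => E (r t), y, fun t => innerSL ℝ (f t), E.continuous.comp_continuousOn h1, ?_, h4,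
    ?_, ?_, (innerSL ℝ).comp_memLp' h7, h8, ?_⟩
  · filter_upwards [h3] with t ht
    ext s
    exact ht s
  · simp only [hE]
    refine Filter.Tendsto.congr (fun I => Finset.sum_congr rfl fun i _ => ?_) h5
    exact ((InnerProductSpace.toDual ℝ (FokkerPlanck.L2 d)).isometry.dist_eq _ _).symm
  · simp only [hE]
    filter_upwards [h6] with t ht
    exact (innerSL ℝ).hasFDerivAt.comp_hasDerivAt t ht
  · simp only [h2]
    exact E.apply_symm_apply ρ₀
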